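/- Let $n\ge 1$, let $\Omega\subseteq\mathbb R^n$ be open and let $\mu$ be a Borel measure on $\Omega$ for which there is a constant $A$ with $\mu(\Omega\cap B(x,r))\le A r^n$ for all $x\in\Omega$, $r>0$ (for example Lebesgue measure). Put $\ell=\mu(\Omega)\in[0,\infty]$. Let $\mathbb P([0,\ell])$ be the class of $p\in L^\infty([0,\ell])$ that have a limit $p(0)=\lim_{t\to0+}p(t)$ with $|p(t)-p(0)|\le \frac{C}{|\ln t|}$ for $0<t<\ell$, $t\le\frac12$, and, in the case $\ell=\infty$, also a limit $p(\infty)=\lim_{t\to\infty}p(t)$ with $|p(t)-p(\infty)|\le\frac{C}{\ln(e+t)}$ for $t>0$. Let $\mathbb P_1([0,\ell])$ be the class of those $p\in\mathbb P([0,\ell])$ with $1<p_-\le p_+<\infty$, where $p_-$ and $p_+$ are the essential infimum and supremum of $p$ over $[0,\ell]$. Throughout, conditions at $\infty$ are imposed only if $\ell=\infty$. For a $\mu$-measurable (real or complex) function $f$ on $\Omega$ let $f^*(t)=\sup\{s\ge0:\mu\{x\in\Omega:|f(x)|>s\}>t\}$. For a weight $w\ge 0$ on $[0,\ell]$ let $\mathcal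 L^{p(\cdot),q(\cdot)}_w(\Omega)$ be the space of those $f$ with $$\|f\|_{\mathcal L^{p(\cdot),q(\cdot)}_w(\Omega)}=\inf\Big\{c>0:\int_0^\ell\Big(\frac{w(t)\,t^{\frac1{p(t)}-\frac1{q(t)}}f^*(t)}{c}\Big)^{q(t)}dt\le1\Big\}<\infty .$$ Theorem (Riesz potential). Let $0<\alpha<n$, let $p,q\in\mathbb P_1([0,\ell])$ with $p(0)>1$, $p(\infty)>1$, and let $p_+<\frac n\alpha$. Let $w(t)=t^{\gamma(t)}$ with $\gamma\in\mathbb P([0,\ell])$ and $$\frac\alpha n-\frac1{p(0)}<\gamma(0)<1-\frac1{p(0)}\qquad\text{and}\qquad \frac\alpha n-\frac1{p(\infty)}<\gamma(\infty)<1-\frac1{p(\infty)},$$ the conditions at $\infty$ being required only if $\mu(\Omega)=\infty$. Define $p_\alpha$ by $\frac1{p_\alpha(t)}=\frac1{p(t)}-\frac\alpha n$. Then the operator $$I^\alpha f(x)=\int_\Omega\frac{f(y)}{|x-y|^{n-\alpha}}\,d\mu(y),\qquad x\in\Omega,$$ is bounded from $\mathcal L^{p(\cdot),q(\cdot)}_w(\Omega)$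 into $\mathcal L^{p_\alpha(\cdot),q(\cdot)}_w(\Omega)$: there is a constant $C$ such that for every $f\in\mathcal L^{p(\cdot),q(\cdot)}_w(\Omega)$ the integral $I^\alpha f(x)$ converges absolutely for $\mu$-almost every $x\in\Omega$, $I^\alpha f\in\mathcal L^{p_\alpha(\cdot),q(\cdot)}_w(\Omega)$, and $$\|I^\alpha f\|_{\mathcal L^{p_\alpha(\cdot),q(\cdot)}_w(\Omega)}\le C\,\|f\|_{\mathcal L^{p(\cdot),q(\cdot)}_w(\Omega)} .$$ -/

import Mathlib

open MeasureTheory Filter Topology Set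
open scoped ENNReal NNReal

noncomputable section

namespace VarLorentz

/-- The interval `(0, ℓ)`, where `0 ≤ ℓ ≤ ∞` (it differs from `[0, ℓ]` by a null set). -/
def interval (ℓ : ℝ≥0∞) : Set ℝ := {t : ℝ | 0 < t ∧ ENNReal.ofReal t < ℓ}

/-- Lebesgue measure on `(0, ℓ)`. -/
def lineMeasure (ℓ : ℝ≥0∞) : Measure ℝ := volume.restrict (interval ℓ)

/-- `p₋`, the essential infimum of `p` over `(0, ℓ)`, as an extended real number. -/
def pMinus (ℓ : ℝ≥0∞) (p : ℝ → ℝ) : EReal :=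
  essInf (fun t => (p t : EReal)) (lineMeasure ℓ)

/-- `p₊`, the essential supremum of `p` over `(0, ℓ)`, as an extended real number. -/
def pPlus (ℓ : ℝ≥0∞) (p : ℝ → ℝ) : EReal :=
  essSup (fun t => (p t : EReal)) (lineMeasure ℓ)

/-- The class `ℙ([0, ℓ])`: `p ∈ L^∞([0, ℓ])` has the limit `p0` at `0` and, if `ℓ = ∞`, the limit
`pInf` at `∞`, and satisfies the logarithmic decay conditions at `0` and, if `ℓ = ∞`, at `∞`.
If `ℓ < ∞`, the number `pInf` plays no role. -/
structure LogDecay (ℓ : ℝ≥0∞) (p : ℝ → ℝ) (p0 pInf : ℝ) : Prop where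
  memLp_top : MemLp p ∞ (lineMeasure ℓ)
  tendsto_zero : Tendsto p (𝓝[interval ℓ] 0) (𝓝 p0)
  decay_zero : ∃ C : ℝ, ∀ t ∈ interval ℓ, t ≤ 1 / 2 → |p t - p0| ≤ C / |Real.log t|
  tendsto_infty : ℓ = ∞ → Tendsto p atTop (𝓝 pInf)
  decay_infty : ℓ = ∞ →
    ∃ C : ℝ, ∀ t ∈ interval ℓ, |p t - pInf| ≤ C / Real.log (Real.exp 1 + t)

/-- The class `ℙ_a([0, ℓ])`: members of `ℙ([0, ℓ])` with `a < p₋ ≤ p₊ < ∞`. -/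
structure LogDecayAbove (a : ℝ) (ℓ : ℝ≥0∞) (p : ℝ → ℝ) (p0 pInf : ℝ) : Prop
    extends LogDecay ℓ p p0 pInf where
  lt_pMinus : (a : EReal) < pMinus ℓ p
  pPlus_lt_top : pPlus ℓ p < ⊤

/-- The Luxemburg norm of `L^{q(·)}([0, ℓ])`,
`inf {c > 0 : ∫₀^ℓ (g(t) / c)^{q(t)} dt ≤ 1}` (equal to `∞` if there is no such `c`). -/
def luxemburgNorm (ℓ : ℝ≥0∞) (q : ℝ → ℝ) (g : ℝ → ℝ≥0∞) : ℝ≥0∞ :=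
  ⨅ (c : ℝ≥0) (_ : 0 < c) (_ : ∫⁻ t, (g t / (c : ℝ≥0∞)) ^ q t ∂(lineMeasure ℓ) ≤ 1), (c : ℝ≥0∞)

section Space

variable {X : Type*} [MeasurableSpace X] {𝕜 : Type*} [RCLike 𝕜]

/-- The non-increasing rearrangement `f*(t) = sup {s ≥ 0 : ν {x : |f(x)| > s} > t}`. -/
def rearrangement (ν : Measure X) (f : X → 𝕜) (t : ℝ) : ℝ≥0∞ :=
  sSup {s : ℝ≥0∞ | ENNReal.ofReal t < ν {x | s < ‖f x‖ₑ}}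

/-- `‖f‖ = ‖ w(t) t^{1/p(t) - 1/q(t)} f*(t) ‖` in `L^{q(·)}([0, ℓ])` with `ℓ = ν(X)`. -/
def lorentzNorm (ν : Measure X) (p q w : ℝ → ℝ) (f : X → 𝕜) : ℝ≥0∞ :=
  luxemburgNorm (ν univ) q
    (fun t => ENNReal.ofReal (w t * t ^ (1 / p t - 1 / q t)) * rearrangement ν f t)

/-- Membership in the weighted variable exponent Lorentz space `𝓛_w^{p(·),q(·)}`. -/
def MemLorentz (ν : Measure X) (p q w : ℝ → ℝ) (f : X → 𝕜) : Prop :=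
  AEStronglyMeasurable f ν ∧ lorentzNorm ν p q w f < ∞

end Space

/-- The power weight `w(t) = t^{γ(t)}`. -/
def powerWeight (γ : ℝ → ℝ) (t : ℝ) : ℝ := t ^ γ t

/-- The exponent `p_α` with `1 / p_α(t) = 1 / p(t) - α / n`. -/
def sobolevExponent (n : ℕ) (α : ℝ) (p : ℝ → ℝ) (t : ℝ) : ℝ := (1 / p t - α / n)⁻¹

section Riesz

variable {n : ℕ} {𝕜 : Type*} [RCLike 𝕜]

/-- The integrand `y ↦ f(y) / |x - y|^{n - α}` of the Riesz potential at `x`. -/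
def rieszIntegrand (α : ℝ) (f : EuclideanSpace ℝ (Fin n) → 𝕜) (x y : EuclideanSpace ℝ (Fin n)) :
    𝕜 :=
  f y / ((‖x - y‖ ^ ((n : ℝ) - α) : ℝ) : 𝕜)

/-- The Riesz potential `I^α f(x) = ∫_Ω f(y) / |x - y|^{n - α} dμ(y)`. -/
def rieszPotential (μ : Measure (EuclideanSpace ℝ (Fin n))) (Ω : Set (EuclideanSpace ℝ (Fin n)))
    (α : ℝ) (f : EuclideanSpace ℝ (Fin n) → 𝕜) (x : EuclideanSpace ℝ (Fin n)) : 𝕜 :=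
  ∫ y in Ω, rieszIntegrand α f x y ∂μ

end Riesz

/-- Upper `n`-regularity of `μ` on `Ω`: `μ(Ω ∩ B(x, r)) ≤ A rⁿ` for all `x ∈ Ω` and `r > 0`.
Lebesgue measure has this property. -/
def UpperRegular {n : ℕ} (μ : Measure (EuclideanSpace ℝ (Fin n)))
    (Ω : Set (EuclideanSpace ℝ (Fin n))) : Prop :=
  ∃ A : ℝ≥0, ∀ x ∈ Ω, ∀ r : ℝ, 0 < r →
    μ (Ω ∩ Metric.ball x r) ≤ (A : ℝ≥0∞) * ENNReal.ofReal (r ^ n)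

end VarLorentz

end

namespace VarLorentz

/-! ### Distribution functions and rearrangements. -/

section Rearrangement

variable {X : Type*} [MeasurableSpace X] {𝕜 : Type*} [RCLike 𝕜]

/-! Write `β = α / n` and `θ = γ + 1 / p`. By upper regularity the Riesz kernel has integral at most
`K τ ^ β` over any set of measure at most `τ` (`exists_setLIntegral_rieszKernel_le`). Cutting `|f|`
into layers at the heights `f*(2 ^ j)` then yields O'Neil's inequality: outside a set of measure `2
^ k` the potential is at most a constant times a Hardy operator applied to the sequence `f*(2 ^ j)`
(`exists_measure_dyadicHardy_lt_absPotential_le`).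

What remains is a weighted Hardy inequality for decreasing functions. Logarithmic decay makes `t ^
θ(t)` comparable to `2 ^ (k θ_k)` on `[2 ^ k, 2 ^ (k + 1))`, where `θ_k` takes one value for `k < 0`
and one for `k ≥ 0`. Likewise `q(t)` may be replaced by a two-valued exponent, up to a constant
factor and a summable error `2 ^ (-|k|)`. So weighted modulars turn into modulars of sequences and
back (`modular_dyadic_le`, `modular_le_of_dyadic`).

The conditions on `γ` say that `β < θ < 1` at both ends. This bounds the weighted Hardy kernel by `2
^ (-ε |k - j|)` (`two_rpow_mul_dyadicHardy_le`), and convolution with such a kernel is bounded for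
the two-valued exponent (`exists_convolution_bound`). `exists_modular_hardy_bound` combines these
facts. -/

theorem rearrangement_antitone (ν : Measure X) (f : X → 𝕜) : Antitone (rearrangement ν f) :=
  fun _ _ hst => sSup_le_sSup fun _ hs => (ENNReal.ofReal_le_ofReal hst).trans_lt hs

theorem rearrangement_eq_zero {ν : Measure X} {t : ℝ} (ht : ν univ ≤ ENNReal.ofReal t)
    (f : X → 𝕜) : rearrangement ν f t = 0 := by
  refine le_antisymm (sSup_le fun s hs => ?_) bot_le
  exact absurd (hs.trans_le (measure_mono (subset_univ _))) (not_lt.2 ht)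

theorem rearrangement_le {ν : Measure X} {t : ℝ} {f : X → 𝕜} {B : ℝ≥0∞}
    (h : ν {x | B < ‖f x‖ₑ} ≤ ENNReal.ofReal t) : rearrangement ν f t ≤ B := by
  refine sSup_le fun s hs => ?_
  by_contra! hB
  have hsub : {x | s < ‖f x‖ₑ} ⊆ {x | B < ‖f x‖ₑ} := fun x hx => hB.trans hx
  exact absurd (hs.trans_le (measure_mono hsub)) (not_lt.2 h)

/-- Every level `s` above `f*(t)` satisfies the bound, and the sets `{|f| > s}` increase to `{|f| >
f*(t)}` as `s` decreases to `f*(t)`, so continuity from below applies. -/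
theorem measure_rearrangement_lt (ν : Measure X) (f : X → 𝕜) (t : ℝ) :
    ν {x | rearrangement ν f t < ‖f x‖ₑ} ≤ ENNReal.ofReal t := by
  rcases eq_or_ne (rearrangement ν f t) ∞ with htop | htop
  · simp [htop]
  obtain ⟨u, hu_anti, hu_gt, hu_lim⟩ :=
    exists_seq_strictAnti_tendsto' (lt_top_iff_ne_top.2 htop)
  have hset : {x | rearrangement ν f t < ‖f x‖ₑ} = ⋃ i, {x | u i < ‖f x‖ₑ} := by
    ext x
    simp only [mem_ofPred_eq, mem_iUnion]
    refine ⟨fun hx => ((hu_lim.eventually_lt_const hx).exists), ?_⟩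
    rintro ⟨i, hi⟩
    exact (hu_gt i).1.trans hi
  have hmono : Monotone fun i => {x | u i < ‖f x‖ₑ} :=
    fun i j hij x hx => (hu_anti.antitone hij).trans_lt hx
  rw [hset, hmono.measure_iUnion]
  refine iSup_le fun i => ?_
  by_contra! hi
  exact absurd (le_sSup (a := u i) hi) (not_le.2 (hu_gt i).1)

end Rearrangement

/-! ### Sequences indexed by `ℤ` with a two-valued exponent. -/

section Sequences

theorem two_rpow_ne_zero (x : ℝ) : (2 : ℝ≥0∞) ^ x ≠ 0 := by simp

theorem two_rpow_ne_top (x : ℝ) : (2 : ℝ≥0∞) ^ x ≠ ∞ := by simp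

theorem two_rpow_add (x y : ℝ) : (2 : ℝ≥0∞) ^ (x + y) = 2 ^ x * 2 ^ y :=
  ENNReal.rpow_add x y (by simp) (by simp)

theorem two_rpow_le {x y : ℝ} (h : x ≤ y) : (2 : ℝ≥0∞) ^ x ≤ 2 ^ y :=
  ENNReal.rpow_le_rpow_of_exponent_le (by simp) h

theorem ofReal_two_zpow (k : ℤ) : ENNReal.ofReal ((2 : ℝ) ^ k) = 2 ^ (k : ℝ) := by
  rw [← Real.rpow_intCast, ← ENNReal.ofReal_rpow_of_pos two_pos]
  simp

/-- Replacing an exponent by a close one costs a constant factor on numbers in `[2 ^ (-m), 1]`. -/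
theorem rpow_le_rpow_add_of_exponent_near {G : ℝ≥0∞} (hG : G ≤ 1) {a b m K : ℝ} (ha : 1 ≤ a)
    (hm : 0 ≤ m) (hK : |a - b| * m ≤ K) : G ^ a ≤ 2 ^ K * G ^ b + 2 ^ (-m) := by
  have hK0 : 0 ≤ K := (mul_nonneg (abs_nonneg _) hm).trans hK
  have h1K : (1 : ℝ≥0∞) ≤ 2 ^ K := by simpa using two_rpow_le hK0
  -- Below `2 ^ (-m)` the error term alone absorbs `G ^ a`, because `a ≥ 1`.
  rcases lt_or_ge G (2 ^ (-m)) with hlt | hge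
  · refine le_add_left ?_
    calc G ^ a ≤ G ^ (1 : ℝ) := ENNReal.rpow_le_rpow_of_exponent_ge hG ha
      _ = G := ENNReal.rpow_one G
      _ ≤ _ := hlt.le
  refine le_add_right ?_
  have hG0 : G ≠ 0 := fun h => two_rpow_ne_zero (-m) (le_antisymm (h ▸ hge) bot_le)
  have hGt : G ≠ ∞ := (hG.trans_lt ENNReal.one_lt_top).ne
  rcases le_total b a with hba | hab
  · calc G ^ a ≤ G ^ b := ENNReal.rpow_le_rpow_of_exponent_ge hG hba
      _ = 1 * G ^ b := (one_mul _).symm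
      _ ≤ _ := by gcongr
  · have : G ^ a = G ^ (a - b) * G ^ b := by
      rw [← ENNReal.rpow_add _ _ hG0 hGt]; ring_nf
    rw [this]
    gcongr
    calc G ^ (a - b) ≤ (2 ^ (-m)) ^ (a - b) := by
          rw [← neg_sub b a, ENNReal.rpow_neg, ENNReal.rpow_neg]
          exact ENNReal.inv_le_inv.2 (ENNReal.rpow_le_rpow hge (by linarith))
      _ = 2 ^ (|a - b| * m) := by
          rw [← ENNReal.rpow_mul, abs_of_nonpos (by linarith : a - b ≤ 0)]; ring_nf
      _ ≤ 2 ^ K := two_rpow_le hK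

theorem tsum_two_rpow_neg_abs_ne_top {δ : ℝ} (hδ : 0 < δ) :
    ∑' i : ℤ, (2 : ℝ≥0∞) ^ (-δ * |(i : ℝ)|) ≠ ∞ := by
  have hr : (2 : ℝ) ^ (-δ) < 1 := Real.rpow_lt_one_of_one_lt_of_neg one_lt_two (by linarith)
  have hs : Summable fun i : ℕ => ((2 : ℝ) ^ (-δ)) ^ i :=
    summable_geometric_of_lt_one (by positivity) hr
  have key : Summable fun i : ℤ => (2 : ℝ) ^ (-δ * |(i : ℝ)|) := by
    refine Summable.of_nat_of_neg ?_ ?_ <;>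
    · refine hs.congr fun i => ?_
      simp [← Real.rpow_natCast, ← Real.rpow_mul]
  have := key.tsum_ofReal_ne_top
  simpa [← ENNReal.ofReal_rpow_of_pos] using this

/-- The exponent which is `a` on the negative and `b` on the nonnegative side. -/
noncomputable def twoSided (a b : ℝ) (k : ℤ) : ℝ := if k < 0 then a else b

/-- Boundedness of a convolution with an exponentially decaying kernel on the sequences `G`
with `∑ G j ^ Q j < ∞`, where `Q` is constant on each side of `0`. -/
theorem exists_convolution_bound {δ : ℝ} (hδ : 0 < δ) (q0 q1 : ℝ) (h0 : 1 ≤ q0) (h1 : 1 ≤ q1) :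
    ∃ N : ℝ≥0, 0 < N ∧ ∀ S : ℝ≥0, ∀ G : ℤ → ℝ≥0∞, (∀ j, G j ≤ 1) →
      ∑' j, G j ^ twoSided q0 q1 j ≤ S →
      (∀ k : ℤ, ∑' j : ℤ, 2 ^ (-δ * |(k : ℝ) - j|) * G j ≤ N) ∧
      ∑' k : ℤ, ((∑' j : ℤ, 2 ^ (-δ * |(k : ℝ) - j|) * G j) / N) ^ twoSided q0 q1 k
        ≤ N * S + N * N := by
  -- Half of the decay rate is spent on summability and half is kept inside the terms.
  set T := ∑' i : ℤ, (2 : ℝ≥0∞) ^ (-(δ / 2) * |(i : ℝ)|) with hTdef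
  have hT : T ≠ ∞ := tsum_two_rpow_neg_abs_ne_top (half_pos hδ)
  have hT1 : 1 ≤ T := by
    refine le_trans ?_ (ENNReal.le_tsum 0)
    simp
  have hN : (T.toNNReal : ℝ≥0∞) = T := ENNReal.coe_toNNReal hT
  have hQ : ∀ k, 1 ≤ twoSided q0 q1 k := fun k => by unfold twoSided; split_ifs <;> assumption
  have hshift : ∀ k : ℤ, ∑' j : ℤ, (2 : ℝ≥0∞) ^ (-(δ / 2) * |(k : ℝ) - j|) = T := fun k => by
    rw [hTdef, ← (Equiv.subLeft k).tsum_eq]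
    simp
  have hshift' : ∀ j : ℤ, ∑' k : ℤ, (2 : ℝ≥0∞) ^ (-(δ / 2) * |(k : ℝ) - j|) = T := fun j => by
    rw [← hshift j]
    simp_rw [abs_sub_comm]
  refine ⟨T.toNNReal, ?_, fun S G hG hS => ?_⟩
  · rw [← ENNReal.coe_pos, hN]; exact zero_lt_one.trans_le hT1
  rw [hN]
  set H : ℤ → ℝ≥0∞ := fun k => ∑' j : ℤ, 2 ^ (-δ * |(k : ℝ) - j|) * G j with hH
  have hle1 : ∀ x : ℝ, (2 : ℝ≥0∞) ^ (-(δ / 2) * |x|) ≤ 1 := fun x => by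
    simpa using two_rpow_le (show -(δ / 2) * |x| ≤ 0 by nlinarith [abs_nonneg x])
  have hsup : ∀ (k : ℤ) (s : ℝ≥0∞), (∀ j : ℤ, 2 ^ (-(δ / 2) * |(k : ℝ) - j|) * G j ≤ s) →
      H k ≤ T * s := fun k s hs => by
    rw [← hshift k, ← ENNReal.tsum_mul_right]
    refine ENNReal.tsum_le_tsum fun j => ?_
    have : (2 : ℝ≥0∞) ^ (-δ * |(k : ℝ) - j|)
        = 2 ^ (-(δ / 2) * |(k : ℝ) - j|) * 2 ^ (-(δ / 2) * |(k : ℝ) - j|) := by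
      rw [← two_rpow_add]; ring_nf
    rw [this, mul_assoc]
    gcongr
    exact hs j
  -- If `k` and `j` lie on the same side, the exponents agree. Otherwise `|k - j| = |k| + |j|`, and
  -- the kernel factors into a summable product that needs only `G j ≤ 1`; these mixed terms produce
  -- `N * N`.
  have hterm : ∀ k j : ℤ, (2 ^ (-(δ / 2) * |(k : ℝ) - j|) * G j) ^ twoSided q0 q1 k ≤
      2 ^ (-(δ / 2) * |(k : ℝ) - j|) * G j ^ twoSided q0 q1 j +
        2 ^ (-(δ / 2) * |(k : ℝ)|) * 2 ^ (-(δ / 2) * |(j : ℝ)|) := fun k j => by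
    have hq := hQ k
    rw [ENNReal.mul_rpow_of_nonneg _ _ (by linarith)]
    have hpow : ((2 : ℝ≥0∞) ^ (-(δ / 2) * |(k : ℝ) - j|)) ^ twoSided q0 q1 k ≤
        2 ^ (-(δ / 2) * |(k : ℝ) - j|) := by
      simpa using ENNReal.rpow_le_rpow_of_exponent_ge (hle1 _) hq
    by_cases hkj : (k < 0 ↔ j < 0)
    · refine le_add_right ?_
      have : twoSided q0 q1 k = twoSided q0 q1 j := by simp [twoSided, hkj]
      rw [← this]
      gcongr
    · refine le_add_left ?_
      have habs : |(k : ℝ) - j| = |(k : ℝ)| + |(j : ℝ)| := by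
        have : |k - j| = |k| + |j| := by
          rcases lt_or_ge k 0 with hk | hk <;> rcases lt_or_ge j 0 with hj | hj
          · exact absurd (by tauto) hkj
          · rw [abs_of_neg hk, abs_of_nonneg hj, abs_of_neg (by omega)]; ring
          · rw [abs_of_neg hj, abs_of_nonneg hk, abs_of_nonneg (by omega)]; ring
          · exact absurd (by constructor <;> intro <;> omega) hkj
        exact_mod_cast this
      rw [← two_rpow_add, ← mul_add, ← habs]
      calc _ ≤ 2 ^ (-(δ / 2) * |(k : ℝ) - j|) * (1 : ℝ≥0∞) ^ twoSided q0 q1 k := by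
            gcongr
            exact hG j
        _ = _ := by simp
  have hTpos : T ≠ 0 := (zero_lt_one.trans_le hT1).ne'
  refine ⟨fun k => ?_, ?_⟩
  · refine (hsup k 1 ?_).trans_eq (mul_one T)
    exact fun j => mul_le_one' (hle1 _) (hG j)
  calc ∑' k : ℤ, (H k / T) ^ twoSided q0 q1 k
      ≤ ∑' k : ℤ, ∑' j : ℤ, (2 ^ (-(δ / 2) * |(k : ℝ) - j|) * G j ^ twoSided q0 q1 j +
        2 ^ (-(δ / 2) * |(k : ℝ)|) * 2 ^ (-(δ / 2) * |(j : ℝ)|)) := by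
        refine ENNReal.tsum_le_tsum fun k => le_trans ?_ (ENNReal.tsum_le_tsum (hterm k))
        have hq : 0 < twoSided q0 q1 k := zero_lt_one.trans_le (hQ k)
        -- Each term is at most `s ^ (1 / Q k)`, so `hsup` bounds the convolution without Hölder's
        -- inequality.
        set s := ∑' j : ℤ, (2 ^ (-(δ / 2) * |(k : ℝ) - j|) * G j) ^ twoSided q0 q1 k
        have h2 : H k / T ≤ s ^ (twoSided q0 q1 k)⁻¹ := by
          rw [ENNReal.div_le_iff_le_mul (Or.inl hTpos) (Or.inl hT), mul_comm]
          refine hsup k _ fun j => ?_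
          rw [ENNReal.le_rpow_inv_iff hq]
          exact ENNReal.le_tsum j
        calc _ ≤ (s ^ (twoSided q0 q1 k)⁻¹) ^ twoSided q0 q1 k := by gcongr
          _ = s := ENNReal.rpow_inv_rpow hq.ne' _
    _ ≤ T * S + T * T := by
        simp_rw [ENNReal.tsum_add, ENNReal.tsum_mul_left]
        rw [ENNReal.tsum_mul_right]
        gcongr
        rw [ENNReal.tsum_comm]
        simp_rw [ENNReal.tsum_mul_right, hshift']
        rw [ENNReal.tsum_mul_left]
        gcongr

end Sequences

/-! ### Integrals of the Riesz kernel over sets of given measure. -/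

section Kernel

variable {n : ℕ} {α : ℝ}

/-- The Riesz kernel `|x - y|^{α - n}`, with the value `0` on the diagonal if `α < n`. -/
noncomputable def rieszKernel (α : ℝ) (x y : EuclideanSpace ℝ (Fin n)) : ℝ≥0∞ :=
  ENNReal.ofReal (‖x - y‖ ^ (α - n))

theorem measurable_rieszKernel :
    Measurable fun z : EuclideanSpace ℝ (Fin n) × EuclideanSpace ℝ (Fin n) =>
      rieszKernel α z.1 z.2 := by
  unfold rieszKernel
  fun_prop

theorem measurable_rieszKernel_right (x : EuclideanSpace ℝ (Fin n)) :
    Measurable (rieszKernel α x) := by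
  unfold rieszKernel
  fun_prop

theorem rieszKernel_comm (x y : EuclideanSpace ℝ (Fin n)) :
    rieszKernel α x y = rieszKernel α y x := by
  simp [rieszKernel, norm_sub_rev]

/-- Beyond distance `R` the first term suffices. Within it, `‖x - y‖` lies in some `(R / 2 ^ (i +
1), R / 2 ^ i]`, where the kernel is at most its value at the inner radius; doubling the outer
radius lets an open ball contain this annulus. -/
theorem rieszKernel_le (hαn : α < n) {R : ℝ} (hR : 0 < R) (x y : EuclideanSpace ℝ (Fin n)) :
    rieszKernel α x y ≤ ENNReal.ofReal (R ^ (α - n)) +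
      ∑' i : ℕ, (Metric.ball x (2 * R * (1 / 2) ^ i)).indicator
        (fun _ => ENNReal.ofReal ((R * (1 / 2) ^ (i + 1)) ^ (α - n))) y := by
  have hneg : α - n < 0 := by linarith
  rcases (norm_nonneg (x - y)).eq_or_lt with h0 | hpos
  · simp [rieszKernel, ← h0, Real.zero_rpow hneg.ne]
  rcases le_total R ‖x - y‖ with hle | hle
  · exact le_add_right (ENNReal.ofReal_le_ofReal
      (Real.rpow_le_rpow_of_nonpos hR hle hneg.le))
  · refine le_add_left ?_
    obtain ⟨i, hi1, hi2⟩ := exists_nat_pow_near_of_lt_one (x := ‖x - y‖ / R) (y := 1 / 2)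
      (by positivity) ((div_le_one hR).2 hle) (by norm_num) (by norm_num)
    refine le_trans ?_ (ENNReal.le_tsum i)
    rw [lt_div_iff₀ hR] at hi1
    rw [div_le_iff₀ hR] at hi2
    have hmem : y ∈ Metric.ball x (2 * R * (1 / 2) ^ i) := by
      rw [Metric.mem_ball', dist_eq_norm]
      have : 0 < R * (1 / 2) ^ i := by positivity
      nlinarith
    rw [indicator_of_mem hmem]
    refine ENNReal.ofReal_le_ofReal (Real.rpow_le_rpow_of_nonpos (by positivity) ?_ hneg.le)
    nlinarith

/-- The Riesz kernel has integral at most `K τ^{α / n}` over sets of measure at most `τ`. -/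
theorem exists_setLIntegral_rieszKernel_le (hα : 0 < α) (hαn : α < n)
    {Ω : Set (EuclideanSpace ℝ (Fin n))}
    {μ : Measure (EuclideanSpace ℝ (Fin n))} (hμ : UpperRegular μ Ω) :
    ∃ K : ℝ≥0, 0 < K ∧ ∀ x ∈ Ω, ∀ τ : ℝ, 0 < τ → ∀ E : Set (EuclideanSpace ℝ (Fin n)),
      μ.restrict Ω E ≤ ENNReal.ofReal τ →
      ∫⁻ y in E, rieszKernel α x y ∂(μ.restrict Ω) ≤ K * ENNReal.ofReal (τ ^ (α / n)) := by
  obtain ⟨A, hA⟩ := hμ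
  have hn : (0 : ℝ) < n := hα.trans hαn
  -- The `i`-th ball below will contribute at most `A * R ^ α * D * r ^ i`, a geometric series
  -- because `α > 0`.
  set r : ℝ := (1 / 2) ^ α with hr
  have hr1 : r < 1 := Real.rpow_lt_one (by norm_num) (by norm_num) hα
  have hr0 : 0 < r := by positivity
  set D : ℝ := (1 / 2) ^ (α - n) * 2 ^ n with hD
  have hD0 : 0 < D := by positivity
  have hsum : ∑' i : ℕ, ENNReal.ofReal (D * r ^ i) ≠ ∞ :=
    ((summable_geometric_of_lt_one hr0.le hr1).mul_left D).tsum_ofReal_ne_top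
  set T := ∑' i : ℕ, ENNReal.ofReal (D * r ^ i) with hT
  refine ⟨1 + A * T.toNNReal, by positivity, fun x hx τ hτ E hE => ?_⟩
  -- At this radius the far part `R ^ (α - n) * τ` and the near part, of order `R ^ α`, are both of
  -- order `τ ^ (α / n)`.
  set R : ℝ := τ ^ (1 / (n : ℝ)) with hRdef
  have hR : 0 < R := by positivity
  have hRα : R ^ α = τ ^ (α / n) := by
    rw [hRdef, ← Real.rpow_mul hτ.le]; ring_nf
  have hRτ : R ^ (α - n) * τ = τ ^ (α / n) := by
    have : τ = R ^ (n : ℝ) := by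
      rw [hRdef, ← Real.rpow_mul hτ.le]; field_simp; simp
    rw [← hRα]
    nth_rewrite 1 [this]
    rw [← Real.rpow_add hR]; ring_nf
  have hball : ∀ i : ℕ, MeasurableSet (Metric.ball x (2 * R * (1 / 2) ^ i)) :=
    fun i => measurableSet_ball
  calc ∫⁻ y in E, rieszKernel α x y ∂(μ.restrict Ω)
      ≤ ∫⁻ y in E, (ENNReal.ofReal (R ^ (α - n)) +
      ∑' i : ℕ, (Metric.ball x (2 * R * (1 / 2) ^ i)).indicator
        (fun _ => ENNReal.ofReal ((R * (1 / 2) ^ (i + 1)) ^ (α - n))) y) ∂(μ.restrict Ω) :=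
        lintegral_mono fun y => rieszKernel_le hαn hR x y
    _ = ENNReal.ofReal (R ^ (α - n)) * μ.restrict Ω E +
        ∑' i : ℕ, ENNReal.ofReal ((R * (1 / 2) ^ (i + 1)) ^ (α - n)) *
          (μ.restrict Ω).restrict E (Metric.ball x (2 * R * (1 / 2) ^ i)) := by
        rw [lintegral_add_left measurable_const, lintegral_tsum
          fun i => (measurable_const.indicator (hball i)).aemeasurable]
        simp_rw [lintegral_indicator_const (hball _)]
        simp
    _ ≤ ENNReal.ofReal (R ^ (α - n)) * ENNReal.ofReal τ +
        ∑' i : ℕ, A * (ENNReal.ofReal (τ ^ (α / n)) * ENNReal.ofReal (D * r ^ i)) := by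
        refine add_le_add (by gcongr) (ENNReal.tsum_le_tsum fun i => ?_)
        calc _ ≤ ENNReal.ofReal ((R * (1 / 2) ^ (i + 1)) ^ (α - n)) *
              (A * ENNReal.ofReal ((2 * R * (1 / 2) ^ i) ^ n)) := by
              gcongr
              refine (Measure.restrict_apply_le _ _).trans ?_
              rw [Measure.restrict_apply (hball i), inter_comm]
              exact hA x hx _ (by positivity)
          _ = _ := by
              rw [mul_left_comm, ← ENNReal.ofReal_mul (by positivity),
                ← ENNReal.ofReal_mul (by positivity), ← hRα]
              congr 2
              have hh : (0 : ℝ) ≤ 1 / 2 := by norm_num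
              clear_value R
              rw [hD, hr, Real.mul_rpow hR.le (by positivity), ← Real.rpow_natCast _ n,
                Real.mul_rpow (by positivity) (by positivity), Real.mul_rpow two_pos.le hR.le,
                ← Real.rpow_natCast _ i, ← Real.rpow_natCast _ i, ← Real.rpow_natCast _ (i + 1),
                ← Real.rpow_mul hh, ← Real.rpow_mul hh, ← Real.rpow_mul hh, ← Real.rpow_natCast _ n]
              have e1 : R ^ α = R ^ (α - n) * R ^ (n : ℝ) := by
                rw [← Real.rpow_add hR]; ring_nf
              have e2 : ((1 : ℝ) / 2) ^ (((i + 1 : ℕ) : ℝ) * (α - n)) * (1 / 2) ^ ((i : ℝ) * n)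
                  = (1 / 2) ^ (α - n) * (1 / 2) ^ (α * i) := by
                rw [← Real.rpow_add (by norm_num), ← Real.rpow_add (by norm_num)]
                congr 1; push_cast; ring
              rw [e1]
              linear_combination (R ^ (α - n) * 2 ^ (n : ℝ) * R ^ (n : ℝ)) * e2
    _ = ↑(1 + A * T.toNNReal) * ENNReal.ofReal (τ ^ (α / n)) := by
        rw [← ENNReal.ofReal_mul (by positivity), hRτ, ENNReal.tsum_mul_left,
          ENNReal.tsum_mul_left, ← hT]
        push_cast
        rw [ENNReal.coe_toNNReal hsum]
        ring

/-- Used for Tonelli's theorem and for choosing subsets of finite measure in level sets. -/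
theorem UpperRegular.sigmaFinite {Ω : Set (EuclideanSpace ℝ (Fin n))}
    {μ : Measure (EuclideanSpace ℝ (Fin n))} (hμ : UpperRegular μ Ω) (hΩ : MeasurableSet Ω) :
    SigmaFinite (μ.restrict Ω) := by
  obtain ⟨A, hA⟩ := hμ
  rcases Ω.eq_empty_or_nonempty with rfl | ⟨x, hx⟩
  · rw [Measure.restrict_empty]; infer_instance
  refine ⟨⟨⟨fun i => Metric.ball x (i + 1), fun _ => trivial, fun i => ?_, ?_⟩⟩⟩
  · rw [Measure.restrict_apply measurableSet_ball, inter_comm]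
    refine (hA x hx _ (by positivity)).trans_lt ?_
    exact ENNReal.mul_lt_top ENNReal.coe_lt_top ENNReal.ofReal_lt_top
  · refine eq_univ_of_forall fun y => mem_iUnion.2 ?_
    obtain ⟨i, hi⟩ := exists_nat_gt (dist y x)
    exact ⟨i, Metric.mem_ball.2 (by linarith)⟩

end Kernel

/-! ### O'Neil's inequality for the Riesz potential. -/

section ONeil

/-- The dyadic form of the operator `t^{β - 1} ∫₀ᵗ φ(s) ds + ∫ₜ^∞ s^{β - 1} φ(s) ds`. -/
noncomputable def dyadicHardy (β : ℝ) (a : ℤ → ℝ≥0∞) (k : ℤ) : ℝ≥0∞ :=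
  ∑' j : ℤ, 2 ^ (if k ≤ j then (j : ℝ) * β else (k : ℝ) * (β - 1) + j) * a j

variable {n : ℕ} {𝕜 : Type*} [RCLike 𝕜]

/-- The Riesz potential of `|f|` with respect to `ν`, as an extended nonnegative number. -/
noncomputable def absPotential (ν : Measure (EuclideanSpace ℝ (Fin n))) (α : ℝ)
    (f : EuclideanSpace ℝ (Fin n) → 𝕜) (x : EuclideanSpace ℝ (Fin n)) : ℝ≥0∞ :=
  ∫⁻ y, ‖f y‖ₑ * rieszKernel α x y ∂ν

/-- A function is dominated by the sum of its dyadic layers. -/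
theorem ae_enorm_le_tsum_layers {X : Type*} [MeasurableSpace X] (ν : Measure X) (f : X → 𝕜)
    (h : ∀ s : ℝ≥0∞, 0 < s → ∃ j : ℤ, rearrangement ν f ((2 : ℝ) ^ j) < s) :
    ∀ᵐ y ∂ν, ‖f y‖ₑ ≤ ∑' j : ℤ, rearrangement ν f ((2 : ℝ) ^ j) *
      {z | rearrangement ν f ((2 : ℝ) ^ (j + 1)) < ‖f z‖ₑ}.indicator 1 y := by
  -- For every `m` this set lies in `{|f| > f*(2 ^ (-m))}`, whose measure is at most `2 ^ (-m)`.
  have hnull : ν {y | ∀ j : ℤ, rearrangement ν f ((2 : ℝ) ^ j) < ‖f y‖ₑ} = 0 := by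
    refine le_antisymm (ENNReal.le_of_forall_pos_le_add fun ε hε _ => ?_) bot_le
    obtain ⟨m, hm⟩ := exists_pow_lt_of_lt_one (show (0 : ℝ) < ε by exact_mod_cast hε)
      (show (1 / 2 : ℝ) < 1 by norm_num)
    calc _ ≤ ν {y | rearrangement ν f ((2 : ℝ) ^ (-(m : ℤ))) < ‖f y‖ₑ} :=
          measure_mono fun y (hy : ∀ j : ℤ, rearrangement ν f ((2 : ℝ) ^ j) < ‖f y‖ₑ) => hy _
      _ ≤ ENNReal.ofReal ((2 : ℝ) ^ (-(m : ℤ))) := measure_rearrangement_lt ν f _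
      _ ≤ ENNReal.ofReal ε := by
          refine ENNReal.ofReal_le_ofReal (le_trans (le_of_eq ?_) hm.le)
          simp
      _ = 0 + ε := by simp
  have hae : ∀ᵐ y ∂ν, ∃ j : ℤ, ‖f y‖ₑ ≤ rearrangement ν f ((2 : ℝ) ^ j) := by
    rw [ae_iff]
    simpa using hnull
  filter_upwards [hae] with y ⟨i, hi⟩
  rcases eq_or_ne ‖f y‖ₑ 0 with h0 | h0
  · rw [h0]; exact bot_le
  have hanti : Antitone fun j : ℤ => rearrangement ν f ((2 : ℝ) ^ j) := fun j l hjl =>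
    rearrangement_antitone ν f (zpow_le_zpow_right₀ one_le_two hjl)
  -- For the least `j` with `f*(2 ^ j) < |f y|`, the point `y` lies in layer `j - 1` and `|f y| ≤
  -- f*(2 ^ (j - 1))`.
  obtain ⟨j, hj, hmin⟩ := Int.exists_least_of_bdd
    (P := fun j : ℤ => rearrangement ν f ((2 : ℝ) ^ j) < ‖f y‖ₑ)
    ⟨i, fun z hz => by
      by_contra! hzi
      exact absurd (hi.trans (hanti hzi.le)) (not_le.2 hz)⟩ (h _ (pos_iff_ne_zero.2 h0))
  refine le_trans ?_ (ENNReal.le_tsum (j - 1))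
  rw [sub_add_cancel, indicator_of_mem (by exact hj)]
  simp only [Pi.one_apply, mul_one]
  by_contra! hlt
  have := hmin _ hlt
  omega

/-- O'Neil's inequality for the Riesz potential, in dyadic form. -/
theorem exists_measure_dyadicHardy_lt_absPotential_le {α : ℝ} (hα : 0 < α) (hαn : α < n)
    {Ω : Set (EuclideanSpace ℝ (Fin n))} (hΩ : MeasurableSet Ω)
    {μ : Measure (EuclideanSpace ℝ (Fin n))} (hμ : UpperRegular μ Ω) :
    ∃ K : ℝ≥0, ∀ f : EuclideanSpace ℝ (Fin n) → 𝕜, StronglyMeasurable f →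
      (∀ s : ℝ≥0∞, 0 < s → ∃ j : ℤ, rearrangement (μ.restrict Ω) f ((2 : ℝ) ^ j) < s) →
      ∀ k : ℤ, μ.restrict Ω
        {x | K * dyadicHardy (α / n) (fun j => rearrangement (μ.restrict Ω) f ((2 : ℝ) ^ j)) k
          < absPotential (μ.restrict Ω) α f x} ≤ ENNReal.ofReal ((2 : ℝ) ^ k) := by
  obtain ⟨K, hK0, hK⟩ := exists_setLIntegral_rieszKernel_le hα hαn hμ
  have := hμ.sigmaFinite hΩ
  refine ⟨2 * K, fun f hf h k => ?_⟩
  set ν := μ.restrict Ω with hν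
  set β := α / n with hβ
  have hn : (0 : ℝ) < n := hα.trans hαn
  have hβ0 : 0 < β := by positivity
  have hβ1 : β < 1 := (div_lt_one hn).2 hαn
  set a : ℤ → ℝ≥0∞ := fun j => rearrangement ν f ((2 : ℝ) ^ j) with ha
  set E : ℤ → Set (EuclideanSpace ℝ (Fin n)) := fun j => {z | a (j + 1) < ‖f z‖ₑ} with hE
  have hEm : ∀ j, MeasurableSet (E j) := fun j =>
    measurableSet_lt measurable_const hf.enorm
  have hEν : ∀ j, ν (E j) ≤ ENNReal.ofReal ((2 : ℝ) ^ (j + 1)) := fun j =>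
    measure_rearrangement_lt ν f _
  have hker : ∀ x : EuclideanSpace ℝ (Fin n), Measurable (rieszKernel α x) := measurable_rieszKernel_right
  set I : ℤ → EuclideanSpace ℝ (Fin n) → ℝ≥0∞ := fun j x =>
    ∫⁻ y in E j, rieszKernel α x y ∂ν with hI
  have hIm : ∀ j, Measurable (I j) := fun j => measurable_rieszKernel.lintegral_prod_right'
  have hU : ∀ x, absPotential ν α f x ≤ ∑' j, a j * I j x := fun x => by
    calc absPotential ν α f x
        ≤ ∫⁻ y, ∑' j, a j * (E j).indicator (rieszKernel α x) y ∂ν := by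
          refine lintegral_mono_ae ?_
          filter_upwards [ae_enorm_le_tsum_layers ν f h] with y hy
          calc _ ≤ (∑' j : ℤ, a j * (E j).indicator 1 y) * rieszKernel α x y := by gcongr
            _ = _ := by
              rw [← ENNReal.tsum_mul_right]
              refine tsum_congr fun j => ?_
              by_cases hy : y ∈ E j <;> simp [hy]
      _ = _ := by
          rw [lintegral_tsum fun j =>
            (((hker x).indicator (hEm j)).const_mul _).aemeasurable]
          refine tsum_congr fun j => ?_
          rw [lintegral_const_mul _ ((hker x).indicator (hEm j)), lintegral_indicator (hEm j)]
  -- The large layers `j ≥ k` are bounded pointwise on `Ω`; the small ones, collected in `W`, only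
  -- on average.
  set V : EuclideanSpace ℝ (Fin n) → ℝ≥0∞ := fun x =>
    ∑' j, if k ≤ j then a j * I j x else 0 with hV
  set W : EuclideanSpace ℝ (Fin n) → ℝ≥0∞ := fun x =>
    ∑' j, if k ≤ j then 0 else a j * I j x with hW
  have hWm : Measurable W := by
    refine Measurable.tsum fun j => ?_
    split_ifs
    · exact measurable_const
    · exact (hIm j).const_mul _
  set B₁ : ℝ≥0∞ := 2 * K * ∑' j : ℤ, if k ≤ j then 2 ^ ((j : ℝ) * β) * a j else 0 with hB₁
  set S : ℝ≥0∞ := ∑' j : ℤ, if k ≤ j then 0 else 2 ^ (j : ℝ) * a j with hS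
  set B₂ : ℝ≥0∞ := 2 * K * (2 ^ ((k : ℝ) * (β - 1)) * S) with hB₂
  have hB : ((2 * K : ℝ≥0) : ℝ≥0∞) * dyadicHardy β a k = B₁ + B₂ := by
    rw [hB₁, hB₂, ← mul_add, hS, ← ENNReal.tsum_mul_left, ← ENNReal.tsum_add, dyadicHardy]
    push_cast
    congr 2
    ext j
    split_ifs
    · simp
    · rw [two_rpow_add]; ring
  have hVB : ∀ x ∈ Ω, V x ≤ B₁ := fun x hx => by
    rw [hB₁, ← ENNReal.tsum_mul_left]
    refine ENNReal.tsum_le_tsum fun j => ?_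
    split_ifs
    · have h1 := hK x hx ((2 : ℝ) ^ (j + 1)) (by positivity) (E j) (hEν j)
      have h2 : ENNReal.ofReal (((2 : ℝ) ^ (j + 1)) ^ β) ≤ 2 * 2 ^ ((j : ℝ) * β) := by
        rw [← ENNReal.ofReal_rpow_of_pos (by positivity), ofReal_two_zpow, ← ENNReal.rpow_mul]
        calc _ ≤ (2 : ℝ≥0∞) ^ (1 + (j : ℝ) * β) := two_rpow_le (by push_cast; nlinarith)
          _ = _ := by rw [two_rpow_add, ENNReal.rpow_one]
      calc a j * I j x ≤ a j * (K * (2 * 2 ^ ((j : ℝ) * β))) := by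
            gcongr
            exact h1.trans (by gcongr)
        _ = _ := by ring
    · simp
  have hsub : ν {x | B₁ + B₂ < absPotential ν α f x} ≤ ν {x | B₂ < W x} := by
    refine measure_mono_ae ?_
    filter_upwards [ae_restrict_mem hΩ] with x hx hxB
    have hxB : B₁ + B₂ < absPotential ν α f x := hxB
    change B₂ < W x
    by_contra! hle
    have : ∑' j, a j * I j x = V x + W x := by
      rw [hV, hW, ← ENNReal.tsum_add]
      refine tsum_congr fun j => ?_
      split_ifs <;> simp
    exact absurd ((hU x).trans (this.trans_le (add_le_add (hVB x hx) hle))) (not_le.2 hxB)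
  rw [hB]
  refine hsub.trans ?_
  -- If `{W > B₂}` had measure above `2 ^ k`, the mean of `W` over a subset `F` of finite measure
  -- above `2 ^ k` would exceed `B₂`; the estimates below show that it does not.
  by_contra! hlt
  obtain ⟨F, hFm, hFsub, hFlt, hFtop⟩ :=
    Measure.exists_subset_measure_lt_top (measurableSet_lt measurable_const hWm) hlt
  have hF0 : ν F ≠ 0 := (bot_le.trans_lt hFlt).ne'
  obtain ⟨x₀, hx₀⟩ := nonempty_of_measure_ne_zero hF0
  have hB₂top : B₂ ≠ ∞ := ((hFsub hx₀ : B₂ < W x₀).trans_le le_top).ne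
  have hFpow : ENNReal.ofReal ((ν F).toReal ^ β) = ν F ^ β := by
    rw [← ENNReal.ofReal_rpow_of_pos (ENNReal.toReal_pos hF0 hFtop.ne),
      ENNReal.ofReal_toReal hFtop.ne]
  -- By Tonelli and the symmetry of the kernel, the kernel bound is applied to `F` with `y` as
  -- centre.
  have hFI : ∀ j, ∫⁻ x in F, I j x ∂ν ≤ 2 * 2 ^ (j : ℝ) * (K * ν F ^ β) := fun j => by
    rw [hI, lintegral_lintegral_swap measurable_rieszKernel.aemeasurable]
    calc ∫⁻ y in E j, ∫⁻ x in F, rieszKernel α x y ∂ν ∂ν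
        ≤ ∫⁻ y in E j, K * ν F ^ β ∂ν := by
          refine lintegral_mono_ae ?_
          filter_upwards [ae_restrict_of_ae (ae_restrict_mem hΩ)] with y hy
          simp_rw [fun x => rieszKernel_comm (α := α) x y]
          rw [← hFpow]
          exact hK y hy _ (ENNReal.toReal_pos hF0 hFtop.ne) F
            (ENNReal.ofReal_toReal hFtop.ne).ge
      _ = K * ν F ^ β * ν (E j) := by simp
      _ ≤ K * ν F ^ β * (2 * 2 ^ (j : ℝ)) := by
          gcongr
          refine (hEν j).trans_eq ?_
          rw [ofReal_two_zpow]
          push_cast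
          rw [two_rpow_add, ENNReal.rpow_one, mul_comm]
      _ = _ := mul_comm _ _
  have hFle : ∫⁻ x in F, W x ∂ν ≤ ∫⁻ _ in F, B₂ ∂ν := by
    calc ∫⁻ x in F, W x ∂ν
        = ∑' j, ∫⁻ x in F, (if k ≤ j then 0 else a j * I j x) ∂ν := by
          refine lintegral_tsum fun j => ?_
          split_ifs
          · exact aemeasurable_const
          · exact ((hIm j).const_mul _).aemeasurable
      _ ≤ ∑' j : ℤ, (2 * K * ν F ^ β) * (if k ≤ j then 0 else 2 ^ (j : ℝ) * a j) := by
          refine ENNReal.tsum_le_tsum fun j => ?_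
          split_ifs
          · simp
          · rw [lintegral_const_mul _ (hIm j)]
            calc _ ≤ a j * (2 * 2 ^ (j : ℝ) * (K * ν F ^ β)) := by gcongr; exact hFI j
              _ = _ := by ring
      _ = 2 * K * ν F ^ β * S := ENNReal.tsum_mul_left
      -- Here `ν F ^ (β - 1) ≤ 2 ^ (k (β - 1))`, because `β < 1` and `ν F > 2 ^ k`.
      _ ≤ 2 * K * (2 ^ ((k : ℝ) * (β - 1)) * ν F) * S := by
          gcongr
          have : ν F ^ β = ν F ^ (β - 1) * ν F := by
            nth_rewrite 3 [← ENNReal.rpow_one (ν F)]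
            rw [← ENNReal.rpow_add _ _ hF0 hFtop.ne]; ring_nf
          rw [this, ENNReal.rpow_mul, ← ofReal_two_zpow]
          gcongr ?_ * _
          rw [← neg_sub 1 β, ENNReal.rpow_neg, ENNReal.rpow_neg]
          exact ENNReal.inv_le_inv.2 (ENNReal.rpow_le_rpow hFlt.le (by linarith))
      _ = ∫⁻ _ in F, B₂ ∂ν := by
          rw [setLIntegral_const, hB₂]; ring
  refine absurd hFle (not_le.2 (setLIntegral_strict_mono hFm hF0 hWm ?_ ?_))
  · rw [setLIntegral_const]
    exact ENNReal.mul_ne_top hB₂top hFtop.ne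
  · exact Eventually.of_forall fun x hx => hFsub hx

end ONeil

/-! ### Passage between weighted modulars and dyadic sequences. -/

section Modular

theorem measurableSet_interval (ℓ : ℝ≥0∞) : MeasurableSet (interval ℓ) :=
  measurableSet_Ioi.inter (measurableSet_lt ENNReal.measurable_ofReal measurable_const)

/-- The dyadic interval `[2 ^ k, 2 ^ (k + 1))`. -/
def dyadicBlock (k : ℤ) : Set ℝ := Ico ((2 : ℝ) ^ k) ((2 : ℝ) ^ (k + 1))

theorem measurableSet_dyadicBlock (k : ℤ) : MeasurableSet (dyadicBlock k) := measurableSet_Ico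

theorem pairwise_disjoint_dyadicBlock : Pairwise (Function.onFun Disjoint dyadicBlock) := by
  have : Monotone fun k : ℤ => (2 : ℝ) ^ k := zpow_right_mono₀ one_le_two
  exact this.pairwise_disjoint_on_Ico_succ

theorem volume_dyadicBlock (k : ℤ) : volume (dyadicBlock k) = 2 ^ (k : ℝ) := by
  rw [dyadicBlock, Real.volume_Ico, zpow_add_one₀ two_ne_zero, ← ofReal_two_zpow]
  ring_nf

theorem exists_two_rpow_of_mem_dyadicBlock {k : ℤ} {t : ℝ} (ht : t ∈ dyadicBlock k) :
    0 < t ∧ (k : ℝ) ≤ Real.logb 2 t ∧ Real.logb 2 t < k + 1 ∧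
      ENNReal.ofReal t = 2 ^ Real.logb 2 t ∧ (t < 1 ↔ k < 0) := by
  have h0 : 0 < t := lt_of_lt_of_le (by positivity) ht.1
  have h1 : (k : ℝ) ≤ Real.logb 2 t := by
    rw [Real.le_logb_iff_rpow_le one_lt_two h0, Real.rpow_intCast]; exact ht.1
  have h2 : Real.logb 2 t < k + 1 := by
    rw [Real.logb_lt_iff_lt_rpow one_lt_two h0]
    have := ht.2
    rw [← Real.rpow_intCast] at this
    exact_mod_cast this
  refine ⟨h0, h1, h2, ?_, ?_⟩
  · conv_lhs => rw [← Real.rpow_logb two_pos (by norm_num) h0]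
    rw [← ENNReal.ofReal_rpow_of_pos two_pos]
    simp
  · rw [← Real.logb_neg_iff one_lt_two h0]
    constructor
    · intro h; exact_mod_cast h1.trans_lt h
    · intro h
      have : ((k + 1 : ℤ) : ℝ) ≤ 0 := by exact_mod_cast h
      push_cast at this
      linarith

theorem lintegral_lineMeasure_eq_tsum (ℓ : ℝ≥0∞) (f : ℝ → ℝ≥0∞) :
    ∫⁻ t, f t ∂(lineMeasure ℓ) = ∑' k : ℤ, ∫⁻ t in dyadicBlock k, f t ∂(lineMeasure ℓ) := by
  rw [← lintegral_iUnion measurableSet_dyadicBlock pairwise_disjoint_dyadicBlock,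
    Measure.restrict_eq_self_of_ae_mem]
  filter_upwards [ae_restrict_mem (measurableSet_interval ℓ)] with t ht
  obtain ⟨k, hk⟩ := exists_mem_Ico_zpow ht.1 one_lt_two
  exact mem_iUnion.2 ⟨k, hk⟩

/-- `p` is within logarithmic distance of the function equal to `p0` on `(0, 1)` and to `p1` on
`[1, ∞)`. -/
def LogNear (ℓ : ℝ≥0∞) (p : ℝ → ℝ) (p0 p1 C : ℝ) : Prop :=
  ∀ᵐ t ∂(lineMeasure ℓ), |p t - (if t < 1 then p0 else p1)| ≤ C ∧
    |p t - (if t < 1 then p0 else p1)| * |Real.logb 2 t| ≤ C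

theorem LogNear.on_dyadicBlock {ℓ : ℝ≥0∞} {p : ℝ → ℝ} {p0 p1 C : ℝ} (h : LogNear ℓ p p0 p1 C)
    (k : ℤ) : ∀ᵐ t ∂((lineMeasure ℓ).restrict (dyadicBlock k)), t ∈ dyadicBlock k ∧
      |p t - twoSided p0 p1 k| ≤ C ∧ |p t - twoSided p0 p1 k| * |Real.logb 2 t| ≤ C := by
  filter_upwards [ae_restrict_of_ae h, ae_restrict_mem (measurableSet_dyadicBlock k)] with t ht hk
  refine ⟨hk, ?_⟩
  have := (exists_two_rpow_of_mem_dyadicBlock hk).2.2.2.2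
  simpa only [twoSided, this] using ht

/-- The exponent `-1 / q` turns `dt` into `dt / t`, for which all dyadic blocks have comparable
mass. -/
theorem weighted_rpow_eq {t x y q u : ℝ} (ht : 0 < t) (hu : ENNReal.ofReal t = 2 ^ u) (hq : 0 < q)
    (hxy : x = y - 1 / q) (g : ℝ≥0∞) :
    (ENNReal.ofReal (t ^ x) * g) ^ q = (2 ^ (u * y) * g) ^ q * 2 ^ (-u) := by
  rw [← ENNReal.ofReal_rpow_of_pos ht, hu, ← ENNReal.rpow_mul, ENNReal.mul_rpow_of_nonneg _ _ hq.le,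
    ENNReal.mul_rpow_of_nonneg _ _ hq.le, ← ENNReal.rpow_mul, ← ENNReal.rpow_mul]
  have : u * x * q = u * y * q + -u := by
    rw [hxy]
    field_simp
    ring
  rw [this, two_rpow_add]
  ring

variable {ℓ : ℝ≥0∞} {e q : ℝ → ℝ} {θ0 θ1 q0 q1 C : ℝ}

/-- A bound for the weighted modular of a decreasing function gives a bound for the modular
of the sequence of its dyadic values. -/
theorem modular_dyadic_le (he : LogNear ℓ e θ0 θ1 C) (hq : LogNear ℓ q q0 q1 C)
    (hq1 : ∀ᵐ t ∂(lineMeasure ℓ), 1 ≤ q t) (hθ0 : 0 ≤ θ0 ∧ θ0 ≤ 1) (hθ1 : 0 ≤ θ1 ∧ θ1 ≤ 1)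
    (h0 : 1 ≤ q0) (h1 : 1 ≤ q1) {φ : ℝ → ℝ≥0∞} (hφ : Antitone φ)
    (hφℓ : ∀ t, ℓ ≤ ENNReal.ofReal t → φ t = 0)
    (hmod : ∫⁻ t, (ENNReal.ofReal (t ^ (e t - 1 / q t)) * φ t) ^ q t ∂(lineMeasure ℓ) ≤ 1)
    {G : ℤ → ℝ≥0∞}
    (hG : ∀ j : ℤ, G j = 2 ^ (-(2 + C)) * (2 ^ ((j : ℝ) * twoSided θ0 θ1 j) * φ (2 ^ j))) :
    (∀ j, G j ≤ 1) ∧ ∑' j, G j ^ twoSided q0 q1 j ≤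
      2 ^ (2 * C + 1) + ∑' j : ℤ, (2 : ℝ≥0∞) ^ (-1 * |(j : ℝ)|) := by
  set ρ : ℝ → ℝ≥0∞ := fun t => (ENNReal.ofReal (t ^ (e t - 1 / q t)) * φ t) ^ q t with hρ
  have hQ : ∀ k, 1 ≤ twoSided q0 q1 k := fun k => by unfold twoSided; split_ifs <;> assumption
  -- As `φ` decreases, `φ (2 ^ j)` is compared with `φ` on the block to its left. Of the loss `2 +
  -- C`, the part `C` pays for the variation of `e`, one unit for the block width, and one for the
  -- spare factor `2` in `2 * G j`. At `j = 0` that block lies on the other side of `1`, which is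
  -- harmless since the exponents are multiplied by `j`.
  have hlower : ∀ j : ℤ, ∀ᵐ t ∂((lineMeasure ℓ).restrict (dyadicBlock (j - 1))),
      1 ≤ q t ∧ |q t - twoSided q0 q1 j| * |(j : ℝ)| ≤ 2 * C ∧
        (2 * G j) ^ q t * 2 ^ (-(j : ℝ)) ≤ ρ t := fun j => by
    filter_upwards [he.on_dyadicBlock (j - 1), hq.on_dyadicBlock (j - 1), ae_restrict_of_ae hq1]
      with t ⟨htb, het, het'⟩ ⟨_, hqt, hqt'⟩ hq1t
    obtain ⟨ht0, hu1, hu2, hu, hside⟩ := exists_two_rpow_of_mem_dyadicBlock htb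
    set u := Real.logb 2 t with hudef
    push_cast at hu1 hu2
    have hC : 0 ≤ C := (abs_nonneg _).trans hqt
    refine ⟨hq1t, ?_, ?_⟩
    · rcases eq_or_ne j 0 with rfl | hj
      · simpa using hC
      · have : twoSided q0 q1 (j - 1) = twoSided q0 q1 j := by
          unfold twoSided
          have : j - 1 < 0 ↔ j < 0 := by omega
          simp [this]
        rw [this] at hqt hqt'
        have hju : |(j : ℝ)| ≤ 1 + |u| := by
          have : |(j : ℝ) - u| ≤ 1 := abs_le.2 ⟨by linarith, by linarith⟩
          have h3 := abs_sub_abs_le_abs_sub (j : ℝ) u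
          linarith
        nlinarith [abs_nonneg (q t - twoSided q0 q1 j)]
    · simp only [hρ]
      rw [weighted_rpow_eq ht0 hu (by linarith) rfl]
      have hle : 2 * G j ≤ 2 ^ (u * e t) * φ t := by
        rw [hG, ← mul_assoc, ← mul_assoc]
        have h2 : (2 : ℝ≥0∞) * 2 ^ (-(2 + C)) * 2 ^ ((j : ℝ) * twoSided θ0 θ1 j)
            ≤ 2 ^ (u * e t) := by
          have : (2 : ℝ≥0∞) * 2 ^ (-(2 + C)) * 2 ^ ((j : ℝ) * twoSided θ0 θ1 j)
              = 2 ^ (1 + -(2 + C) + (j : ℝ) * twoSided θ0 θ1 j) := by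
            rw [two_rpow_add, two_rpow_add, ENNReal.rpow_one]
          rw [this]
          refine two_rpow_le ?_
          have hd : -C ≤ u * (e t - twoSided θ0 θ1 (j - 1)) := by
            rw [← abs_mul, mul_comm] at het'
            exact (abs_le.1 het').1
          have hw : (j : ℝ) * twoSided θ0 θ1 j ≤ u * twoSided θ0 θ1 (j - 1) + 1 := by
            unfold twoSided
            rcases lt_trichotomy j 0 with hj | rfl | hj
            · rw [if_pos hj, if_pos (by omega)]; nlinarith
            · rw [if_neg (by omega), if_pos (by omega)]; push_cast at *; nlinarith
            · rw [if_neg (by omega), if_neg (by omega)]; nlinarith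
          nlinarith
        refine mul_le_mul' h2 (hφ ?_)
        have := htb.2
        rw [sub_add_cancel] at this
        exact this.le
      exact mul_le_mul' (ENNReal.rpow_le_rpow hle (by linarith)) (two_rpow_le (by linarith))
  have hblock : ∀ j : ℤ, ¬ ℓ ≤ ENNReal.ofReal ((2 : ℝ) ^ j) →
      lineMeasure ℓ (dyadicBlock (j - 1)) = 2 ^ ((j : ℝ) - 1) := fun j hj => by
    rw [lineMeasure, Measure.restrict_apply (measurableSet_dyadicBlock _),
      inter_eq_self_of_subset_left, volume_dyadicBlock]
    · push_cast; rfl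
    · intro t ht
      refine ⟨(exists_two_rpow_of_mem_dyadicBlock ht).1, lt_of_le_of_lt ?_ (not_le.1 hj)⟩
      have := ht.2
      rw [sub_add_cancel] at this
      exact ENNReal.ofReal_le_ofReal this.le
  have hGzero : ∀ j : ℤ, ℓ ≤ ENNReal.ofReal ((2 : ℝ) ^ j) → G j = 0 := fun j hj => by
    rw [hG, hφℓ _ hj]; simp
  -- If `G j > 1`, then `(2 * G j) ^ q ≥ 2 * G j`; the factor `2` offsets the block measure `2 ^ (j
  -- - 1)`, and the modular would exceed `1`.
  have hG1 : ∀ j, G j ≤ 1 := fun j => by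
    by_cases hj : ℓ ≤ ENNReal.ofReal ((2 : ℝ) ^ j)
    · simp [hGzero j hj]
    by_contra! hlt
    have h2 : 2 * G j * 2 ^ (-(j : ℝ)) * 2 ^ ((j : ℝ) - 1) ≤ 1 := by
      rw [← hblock j hj, ← setLIntegral_const]
      refine le_trans (lintegral_mono_ae ?_) ((setLIntegral_le_lintegral _ _).trans hmod)
      filter_upwards [hlower j] with t ⟨hq1t, _, hle⟩
      refine le_trans ?_ hle
      gcongr
      have : 1 ≤ 2 * G j := hlt.le.trans (le_mul_of_one_le_left bot_le one_le_two)
      simpa using ENNReal.rpow_le_rpow_of_exponent_le this hq1t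
    have h3 : 2 * G j * 2 ^ (-(j : ℝ)) * 2 ^ ((j : ℝ) - 1) = G j := by
      have : (2 : ℝ≥0∞) * (2 ^ (-(j : ℝ)) * 2 ^ ((j : ℝ) - 1)) = 1 := by
        rw [← two_rpow_add]
        nth_rewrite 1 [← ENNReal.rpow_one 2]
        rw [← two_rpow_add]
        ring_nf
        simp
      calc _ = G j * (2 * (2 ^ (-(j : ℝ)) * 2 ^ ((j : ℝ) - 1))) := by ring
        _ = G j := by rw [this, mul_one]
    rw [h3] at h2
    exact absurd hlt (not_lt.2 h2)
  refine ⟨hG1, ?_⟩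
  have hterm : ∀ j : ℤ, G j ^ twoSided q0 q1 j ≤
      2 ^ (2 * C + 1) * ∫⁻ t in dyadicBlock (j - 1), ρ t ∂(lineMeasure ℓ)
        + 2 ^ (-1 * |(j : ℝ)|) := fun j => by
    by_cases hj : ℓ ≤ ENNReal.ofReal ((2 : ℝ) ^ j)
    · rw [hGzero j hj, ENNReal.zero_rpow_of_pos (zero_lt_one.trans_le (hQ j))]
      exact bot_le
    have hb := hblock j hj
    set J := ∫⁻ t in dyadicBlock (j - 1), ρ t ∂(lineMeasure ℓ) with hJ
    have key : G j ^ twoSided q0 q1 j * 2 ^ ((j : ℝ) - 1) ≤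
        (2 ^ (2 * C + 1) * J + 2 ^ (-1 * |(j : ℝ)|)) * 2 ^ ((j : ℝ) - 1) := by
      calc G j ^ twoSided q0 q1 j * 2 ^ ((j : ℝ) - 1)
          = ∫⁻ t in dyadicBlock (j - 1), G j ^ twoSided q0 q1 j ∂(lineMeasure ℓ) := by
            rw [setLIntegral_const, hb]
        _ ≤ ∫⁻ t in dyadicBlock (j - 1),
              (2 ^ (2 * C) * 2 ^ (j : ℝ) * ρ t + 2 ^ (-1 * |(j : ℝ)|)) ∂(lineMeasure ℓ) := by
            refine lintegral_mono_ae ?_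
            filter_upwards [hlower j] with t ⟨hq1t, hqt, hle⟩
            have hsw := rpow_le_rpow_add_of_exponent_near (hG1 j) (hQ j) (abs_nonneg (j : ℝ))
              (b := q t) (K := 2 * C) (by rw [abs_sub_comm]; exact hqt)
            rw [neg_one_mul]
            refine hsw.trans ?_
            rw [mul_assoc]
            refine add_le_add (mul_le_mul' le_rfl ?_) le_rfl
            calc G j ^ q t ≤ (2 * G j) ^ q t :=
                  ENNReal.rpow_le_rpow (le_mul_of_one_le_left bot_le one_le_two) (by linarith)
              _ = 2 ^ (j : ℝ) * ((2 * G j) ^ q t * 2 ^ (-(j : ℝ))) := by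
                  rw [mul_left_comm, ← two_rpow_add]; simp
              _ ≤ _ := by gcongr
        _ = 2 ^ (2 * C) * 2 ^ (j : ℝ) * J + 2 ^ (-1 * |(j : ℝ)|) * 2 ^ ((j : ℝ) - 1) := by
            rw [lintegral_add_right _ measurable_const, setLIntegral_const, hb,
              lintegral_const_mul' _ _ (ENNReal.mul_ne_top (two_rpow_ne_top _) (two_rpow_ne_top _))]
        _ = _ := by
            have : (2 : ℝ≥0∞) ^ (2 * C) * 2 ^ (j : ℝ) = 2 ^ (2 * C + 1) * 2 ^ ((j : ℝ) - 1) := by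
              rw [← two_rpow_add, ← two_rpow_add]; ring_nf
            rw [this]; ring
    rwa [ENNReal.mul_le_mul_iff_left (two_rpow_ne_zero _) (two_rpow_ne_top _)] at key
  refine (ENNReal.tsum_le_tsum hterm).trans ?_
  rw [ENNReal.tsum_add, ENNReal.tsum_mul_left]
  gcongr
  have : ∑' j : ℤ, ∫⁻ t in dyadicBlock (j - 1), ρ t ∂(lineMeasure ℓ) ≤ 1 := by
    have h := (Equiv.subRight (1 : ℤ)).tsum_eq
      (fun j => ∫⁻ t in dyadicBlock j, ρ t ∂(lineMeasure ℓ))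
    rw [← lintegral_lineMeasure_eq_tsum] at h
    exact h.trans_le hmod
  exact mul_le_of_le_one_right bot_le this

/-- A bound for the modular of the dyadic values of a decreasing function gives a bound for its
weighted modular. -/
theorem modular_le_of_dyadic (he : LogNear ℓ e θ0 θ1 C) (hq : LogNear ℓ q q0 q1 C)
    (hq1 : ∀ᵐ t ∂(lineMeasure ℓ), 1 ≤ q t) {β : ℝ} (hθ0 : β ≤ θ0 ∧ θ0 ≤ β + 1)
    (hθ1 : β ≤ θ1 ∧ θ1 ≤ β + 1) {ψ : ℝ → ℝ≥0∞} (hψ : Antitone ψ) {H : ℤ → ℝ≥0∞}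
    (hH : ∀ k, H k ≤ 1) {S L : ℝ≥0} (hS : ∑' k, H k ^ twoSided q0 q1 k ≤ S) (hL1 : 1 ≤ L)
    (hL : 2 ^ (2 * C) * S + ∑' j : ℤ, (2 : ℝ≥0∞) ^ (-1 * |(j : ℝ)|) ≤ L)
    (hψH : ∀ k : ℤ, 2 ^ ((k : ℝ) * (twoSided θ0 θ1 k - β)) * ψ (2 ^ k) ≤
      2 ^ (-(1 + C)) * (H k / L)) :
    ∫⁻ t, (ENNReal.ofReal (t ^ (e t - β - 1 / q t)) * ψ t) ^ q t ∂(lineMeasure ℓ) ≤ 1 := by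
  have hL0 : (L : ℝ≥0∞) ≠ 0 := by
    exact_mod_cast (zero_lt_one.trans_le hL1).ne'
  have hblock : ∀ k : ℤ, lineMeasure ℓ (dyadicBlock k) ≤ 2 ^ (k : ℝ) := fun k => by
    rw [← volume_dyadicBlock]
    exact Measure.restrict_apply_le _ _
  have hterm : ∀ k : ℤ, ∫⁻ t in dyadicBlock k,
      (ENNReal.ofReal (t ^ (e t - β - 1 / q t)) * ψ t) ^ q t ∂(lineMeasure ℓ) ≤
      (2 ^ (2 * C) * H k ^ twoSided q0 q1 k + 2 ^ (-1 * |(k : ℝ)|)) / L := fun k => by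
    calc _ ≤ ∫⁻ t in dyadicBlock k, (2 ^ (2 * C) * H k ^ twoSided q0 q1 k + 2 ^ (-1 * |(k : ℝ)|))
            / L * 2 ^ (-(k : ℝ)) ∂(lineMeasure ℓ) := by
          refine lintegral_mono_ae ?_
          filter_upwards [he.on_dyadicBlock k, hq.on_dyadicBlock k, ae_restrict_of_ae hq1]
            with t ⟨htb, het, het'⟩ ⟨_, hqt, hqt'⟩ hq1t
          obtain ⟨ht0, hu1, hu2, hu, hside⟩ := exists_two_rpow_of_mem_dyadicBlock htb
          set u := Real.logb 2 t with hudef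
          rw [weighted_rpow_eq ht0 hu (by linarith) rfl]
          have hle : 2 ^ (u * (e t - β)) * ψ t ≤ H k / L := by
            have h2 : (2 : ℝ≥0∞) ^ (u * (e t - β)) ≤
                2 ^ (1 + C) * 2 ^ ((k : ℝ) * (twoSided θ0 θ1 k - β)) := by
              rw [← two_rpow_add]
              refine two_rpow_le ?_
              have hd : u * (e t - twoSided θ0 θ1 k) ≤ C := by
                rw [← abs_mul, mul_comm] at het'
                exact (abs_le.1 het').2
              have hw : u * (twoSided θ0 θ1 k - β) ≤ k * (twoSided θ0 θ1 k - β) + 1 := by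
                have : β ≤ twoSided θ0 θ1 k ∧ twoSided θ0 θ1 k ≤ β + 1 := by
                  unfold twoSided; split_ifs <;> assumption
                nlinarith
              nlinarith
            calc _ ≤ 2 ^ (1 + C) * 2 ^ ((k : ℝ) * (twoSided θ0 θ1 k - β)) * ψ (2 ^ k) :=
                  mul_le_mul' h2 (hψ htb.1)
              _ = 2 ^ (1 + C) * (2 ^ ((k : ℝ) * (twoSided θ0 θ1 k - β)) * ψ (2 ^ k)) :=
                  mul_assoc _ _ _
              _ ≤ 2 ^ (1 + C) * (2 ^ (-(1 + C)) * (H k / L)) :=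
                  mul_le_mul' le_rfl (hψH k)
              _ = H k / L := by rw [← mul_assoc, ← two_rpow_add]; simp
          have hpow : (2 ^ (u * (e t - β)) * ψ t) ^ q t ≤
              (2 ^ (2 * C) * H k ^ twoSided q0 q1 k + 2 ^ (-1 * |(k : ℝ)|)) / L := by
            -- Since `L ≥ 1` and `q t ≥ 1`, one factor `1 / L` comes out of the power; it finally
            -- brings the sum down to `1`.
            calc _ ≤ (H k / L) ^ q t := ENNReal.rpow_le_rpow hle (by linarith)
              _ = H k ^ q t / (L : ℝ≥0∞) ^ q t := ENNReal.div_rpow_of_nonneg _ _ (by linarith)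
              _ ≤ H k ^ q t / L := by
                  gcongr
                  have : (1 : ℝ≥0∞) ≤ L := by exact_mod_cast hL1
                  simpa using ENNReal.rpow_le_rpow_of_exponent_le this hq1t
              _ ≤ _ := by
                  gcongr
                  rw [neg_one_mul]
                  refine rpow_le_rpow_add_of_exponent_near (hH k) hq1t (abs_nonneg _) ?_
                  have hju : |(k : ℝ)| ≤ 1 + |u| := by
                    have : |(k : ℝ) - u| ≤ 1 := abs_le.2 ⟨by linarith, by linarith⟩
                    have h3 := abs_sub_abs_le_abs_sub (k : ℝ) u
                    linarith
                  nlinarith [abs_nonneg (q t - twoSided q0 q1 k)]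
          gcongr ?_ * ?_
          exact two_rpow_le (by linarith)
      _ ≤ (2 ^ (2 * C) * H k ^ twoSided q0 q1 k + 2 ^ (-1 * |(k : ℝ)|)) / L *
            (2 ^ (-(k : ℝ)) * 2 ^ (k : ℝ)) := by
          rw [setLIntegral_const, mul_assoc]
          gcongr
          exact hblock k
      _ = _ := by rw [← two_rpow_add]; simp
  rw [lintegral_lineMeasure_eq_tsum]
  refine (ENNReal.tsum_le_tsum hterm).trans ?_
  simp_rw [div_eq_mul_inv]
  rw [ENNReal.tsum_mul_right, ENNReal.tsum_add, ENNReal.tsum_mul_left, ← div_eq_mul_inv]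
  refine ENNReal.div_le_of_le_mul ?_
  rw [one_mul]
  refine le_trans ?_ hL
  gcongr

/-- The weighted dyadic Hardy operator is dominated by a convolution. -/
theorem two_rpow_mul_dyadicHardy_le {β ε : ℝ} (hθ0 : ε ≤ θ0 - β ∧ ε ≤ 1 - θ0)
    (hθ1 : ε ≤ θ1 - β ∧ ε ≤ 1 - θ1) (a : ℤ → ℝ≥0∞) (k : ℤ) :
    2 ^ ((k : ℝ) * (twoSided θ0 θ1 k - β)) * dyadicHardy β a k ≤
      ∑' j : ℤ, 2 ^ (-ε * |(k : ℝ) - j|) * (2 ^ ((j : ℝ) * twoSided θ0 θ1 j) * a j) := by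
  rw [dyadicHardy, ← ENNReal.tsum_mul_left]
  refine ENNReal.tsum_le_tsum fun j => ?_
  rw [← mul_assoc, ← mul_assoc, ← two_rpow_add, ← two_rpow_add]
  refine mul_le_mul' (two_rpow_le ?_) le_rfl
  unfold twoSided
  obtain ⟨h1, h2⟩ := hθ0
  obtain ⟨h3, h4⟩ := hθ1
  -- The gap `θ - β` gives the decay for `j ≥ k`, the gap `1 - θ` for `j < k`. If `k` and `j` have
  -- different signs, each contributes its own side's gap.
  by_cases hkj : k ≤ j
  · have hkj' : (k : ℝ) ≤ j := by exact_mod_cast hkj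
    rw [if_pos hkj, abs_of_nonpos (by linarith)]
    by_cases hk : k < 0 <;> by_cases hj : j < 0
    · rw [if_pos hk, if_pos hj]; nlinarith
    · have hk' : (k : ℝ) < 0 := by exact_mod_cast hk
      have hj' : (0 : ℝ) ≤ j := by exact_mod_cast not_lt.1 hj
      rw [if_pos hk, if_neg hj]; nlinarith
    · omega
    · rw [if_neg hk, if_neg hj]; nlinarith
  · have hkj' : (j : ℝ) < k := by exact_mod_cast not_le.1 hkj
    rw [if_neg hkj, abs_of_pos (by linarith)]
    by_cases hk : k < 0 <;> by_cases hj : j < 0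
    · rw [if_pos hk, if_pos hj]; nlinarith
    · omega
    · have hk' : (0 : ℝ) ≤ k := by exact_mod_cast not_lt.1 hk
      have hj' : (j : ℝ) < 0 := by exact_mod_cast hj
      rw [if_neg hk, if_pos hj]; nlinarith
    · rw [if_neg hk, if_neg hj]; nlinarith

end Modular

/-! ### Logarithmic closeness to a two-valued function. -/

section LogNear

variable {ℓ : ℝ≥0∞} {p r : ℝ → ℝ} {p0 p1 r0 r1 C D : ℝ}

theorem LogNear.mono (h : LogNear ℓ p p0 p1 C) (hCD : C ≤ D) : LogNear ℓ p p0 p1 D := by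
  filter_upwards [h] with t ht
  exact ⟨ht.1.trans hCD, ht.2.trans hCD⟩

theorem LogNear.of_abs_sub_le (h : LogNear ℓ p p0 p1 C)
    (hr : ∀ᵐ t ∂(lineMeasure ℓ), |r t - r0| ≤ |p t - p0| ∧ |r t - r1| ≤ |p t - p1|) :
    LogNear ℓ r r0 r1 C := by
  filter_upwards [h, hr] with t ht hrt
  have : |r t - (if t < 1 then r0 else r1)| ≤ |p t - (if t < 1 then p0 else p1)| := by
    split_ifs
    exacts [hrt.1, hrt.2]
  exact ⟨this.trans ht.1, (mul_le_mul_of_nonneg_right this (abs_nonneg _)).trans ht.2⟩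

theorem LogNear.add (h : LogNear ℓ p p0 p1 C) (h' : LogNear ℓ r r0 r1 D) :
    LogNear ℓ (fun t => p t + r t) (p0 + r0) (p1 + r1) (C + D) := by
  filter_upwards [h, h'] with t ht ht'
  have : |p t + r t - (if t < 1 then p0 + r0 else p1 + r1)| ≤
      |p t - (if t < 1 then p0 else p1)| + |r t - (if t < 1 then r0 else r1)| := by
    refine le_trans (le_of_eq ?_) (abs_add_le _ _)
    split_ifs <;> ring_nf
  refine ⟨this.trans (add_le_add ht.1 ht'.1),
    (mul_le_mul_of_nonneg_right this (abs_nonneg _)).trans ?_⟩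
  rw [add_mul]
  exact add_le_add ht.2 ht'.2

theorem LogNear.one_div (h : LogNear ℓ p p0 p1 C) (hp : ∀ᵐ t ∂(lineMeasure ℓ), 1 ≤ p t)
    (h0 : 1 ≤ p0) (h1 : 1 ≤ p1) : LogNear ℓ (fun t => 1 / p t) (1 / p0) (1 / p1) C := by
  have key : ∀ a b : ℝ, 1 ≤ a → 1 ≤ b → |1 / a - 1 / b| ≤ |a - b| := fun a b ha hb => by
    have : 1 / a - 1 / b = (b - a) / (a * b) := by
      field_simp
    rw [this, abs_div, abs_sub_comm]
    refine div_le_self (abs_nonneg _) ?_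
    rw [abs_of_pos (by positivity)]
    nlinarith
  refine h.of_abs_sub_le ?_
  filter_upwards [hp] with t ht
  exact ⟨key _ _ ht h0, key _ _ ht h1⟩

/-- Truncating the limits at `1` brings them no further from values that are at least `1`. This
supplies limits at least `1` for `q`. -/
theorem LogNear.max_one (h : LogNear ℓ p p0 p1 C) (hp : ∀ᵐ t ∂(lineMeasure ℓ), 1 ≤ p t) :
    LogNear ℓ p (max p0 1) (max p1 1) C := by
  have key : ∀ a b : ℝ, 1 ≤ a → |a - max b 1| ≤ |a - b| := fun a b ha => by
    rcases le_total b 1 with hb | hb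
    · rw [max_eq_right hb, abs_of_nonneg (by linarith), abs_of_nonneg (by linarith)]
      linarith
    · rw [max_eq_left hb]
  refine h.of_abs_sub_le ?_
  filter_upwards [hp] with t ht
  exact ⟨key _ _ ht, key _ _ ht⟩

/-- Away from `0` and `∞` the logarithm is bounded, so boundedness of `p` is enough there. For `ℓ <
∞` this covers `[1, ℓ)`, and `p0` can serve on both sides of `1`; finite and infinite `ℓ` are then
treated alike. -/
theorem LogDecay.exists_logNear {pInf : ℝ} (h : LogDecay ℓ p p0 pInf) :
    ∃ C, LogNear ℓ p p0 (if ℓ = ∞ then pInf else p0) C := by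
  set p1 := if ℓ = ∞ then pInf else p0 with hp1
  obtain ⟨B, hB⟩ : ∃ B : ℝ, ∀ᵐ t ∂(lineMeasure ℓ), |p t| ≤ B := by
    have hlt := h.memLp_top.2
    rw [eLpNorm_exponent_top] at hlt
    refine ⟨(eLpNormEssSup p (lineMeasure ℓ)).toReal, ?_⟩
    filter_upwards [ae_le_eLpNormEssSup (f := p) (μ := lineMeasure ℓ)] with t ht
    have := ENNReal.toReal_mono hlt.ne ht
    simpa using this
  obtain ⟨C₀, hC₀⟩ := h.decay_zero
  have hC₁ : ∀ t ∈ interval ℓ, 1 ≤ t → ℓ ≠ ∞ → Real.log t ≤ |Real.log ℓ.toReal| :=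
    fun t ht ht1 hℓ => by
      have htl := ht.2.le
      rw [ENNReal.ofReal_le_iff_le_toReal hℓ] at htl
      exact (Real.log_le_log (by linarith) htl).trans (le_abs_self _)
  set C₁ := |Real.log ℓ.toReal| with hC₁def
  obtain ⟨C₂, hC₂⟩ : ∃ C₂ : ℝ, ℓ = ∞ →
      ∀ t ∈ interval ℓ, |p t - p1| ≤ C₂ / Real.log (Real.exp 1 + t) := by
    by_cases hℓ : ℓ = ∞
    · obtain ⟨C₂, hC₂⟩ := h.decay_infty hℓ
      refine ⟨C₂, fun _ => ?_⟩
      rwa [hp1, if_pos hℓ]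
    · exact ⟨0, fun h => absurd h hℓ⟩
  have hlog2 : 1 / 2 < Real.log 2 := by linarith [Real.log_two_gt_d9]
  set R := |B| + |p0| + |p1| with hR
  -- The factor `2` exceeds `1 / log 2` and pays for the change to base `2`.
  refine ⟨R + 2 * (|C₀| + R + R * C₁ + |C₂|), ?_⟩
  filter_upwards [hB, ae_restrict_mem (measurableSet_interval ℓ)] with t htB ht
  have ht0 : 0 < t := ht.1
  set d := |p t - (if t < 1 then p0 else p1)| with hd
  have hd0 : 0 ≤ d := abs_nonneg _
  have hdR : d ≤ R := by
    rw [hd, hR]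
    have := le_abs_self B
    split_ifs
    · linarith [abs_sub (p t) p0, abs_nonneg p1]
    · linarith [abs_sub (p t) p1, abs_nonneg p0]
  have hmain : d * |Real.log t| ≤ |C₀| + R + R * C₁ + |C₂| := by
    have hR0 : 0 ≤ R := by positivity
    have hC1 : 0 ≤ R * C₁ := mul_nonneg hR0 (abs_nonneg _)
    rcases lt_or_ge t 1 with h1 | h1
    · have hdt : d = |p t - p0| := by rw [hd, if_pos h1]
      have hlt : Real.log t < 0 := Real.log_neg ht0 h1
      rcases le_or_gt t (1 / 2) with h2 | h2
      · have := hC₀ t ht h2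
        rw [← hdt, le_div_iff₀ (abs_pos.2 hlt.ne)] at this
        linarith [le_abs_self C₀, abs_nonneg C₂]
      · have h3 : |Real.log t| ≤ 1 := by
          rw [abs_of_neg hlt]
          have := Real.log_lt_log (by norm_num) h2
          rw [one_div, Real.log_inv] at this
          linarith [Real.log_two_lt_d9]
        nlinarith [abs_nonneg C₀, abs_nonneg C₂]
    · have hdt : d = |p t - p1| := by rw [hd, if_neg (not_lt.2 h1)]
      have hl0 : 0 ≤ Real.log t := Real.log_nonneg h1
      rw [abs_of_nonneg hl0]
      by_cases hℓ : ℓ = ∞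
      · have h3 := hC₂ hℓ t ht
        have hexp : 0 < Real.exp 1 := Real.exp_pos 1
        have hle : Real.log t ≤ Real.log (Real.exp 1 + t) := Real.log_le_log ht0 (by linarith)
        have hpos : 0 < Real.log (Real.exp 1 + t) :=
          Real.log_pos (by linarith [Real.add_one_le_exp (1 : ℝ)])
        rw [← hdt, le_div_iff₀ hpos] at h3
        have := mul_le_mul_of_nonneg_left hle hd0
        linarith [le_abs_self C₂, abs_nonneg C₀]
      · have := mul_le_mul hdR (hC₁ t ht h1 hℓ) hl0 hR0
        linarith [abs_nonneg C₀, abs_nonneg C₂]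
  have hnn : 0 ≤ |C₀| + R + R * C₁ + |C₂| :=
    (mul_nonneg hd0 (abs_nonneg _)).trans hmain
  have hR0 : 0 ≤ R := hd0.trans hdR
  refine ⟨by linarith, ?_⟩
  rw [Real.logb, abs_div, abs_of_pos (by linarith : 0 < Real.log 2), ← mul_div_assoc,
    div_le_iff₀ (by linarith)]
  nlinarith

theorem LogDecayAbove.ae_lt {a pInf : ℝ} (h : LogDecayAbove a ℓ p p0 pInf) :
    ∀ᵐ t ∂(lineMeasure ℓ), a < p t := by
  filter_upwards [ae_lt_of_lt_essInf h.lt_pMinus] with t ht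
  exact_mod_cast ht

end LogNear

/-! ### Null sets and the combined power weight. -/

section Congruence

variable {X : Type*} [MeasurableSpace X] {𝕜 : Type*} [RCLike 𝕜] {ν : Measure X} {f g : X → 𝕜}

theorem rearrangement_congr (h : f =ᵐ[ν] g) : rearrangement ν f = rearrangement ν g := by
  funext t
  unfold rearrangement
  congr 1
  ext s
  have : ν {x | s < ‖f x‖ₑ} = ν {x | s < ‖g x‖ₑ} := by
    refine measure_congr ?_
    filter_upwards [h] with x hx
    exact congrArg (fun z : 𝕜 => s < ‖z‖ₑ) hx
  simp [this]

/-- Weight and Lorentz power merge into one exponent: `e` for the source space and `e - β` for the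
target. -/
theorem lorentz_modular_eq {ℓ : ℝ≥0∞} {p q γ e : ℝ → ℝ} (he : ∀ t, e t = γ t + 1 / p t)
    (φ : ℝ → ℝ≥0∞) (c : ℝ≥0∞) :
    ∫⁻ t, (ENNReal.ofReal (powerWeight γ t * t ^ (1 / p t - 1 / q t)) * φ t / c) ^ q t
      ∂(lineMeasure ℓ) =
    ∫⁻ t, (ENNReal.ofReal (t ^ (e t - 1 / q t)) * (φ t / c)) ^ q t ∂(lineMeasure ℓ) := by
  refine lintegral_congr_ae ?_
  filter_upwards [ae_restrict_mem (measurableSet_interval ℓ)] with t ht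
  rw [powerWeight, ← Real.rpow_add ht.1, he, mul_div_assoc]
  ring_nf

end Congruence

/-! ### The Riesz integrand. -/

section Potential

variable {n : ℕ} {𝕜 : Type*} [RCLike 𝕜] {α : ℝ}

theorem enorm_rieszIntegrand (f : EuclideanSpace ℝ (Fin n) → 𝕜)
    (x y : EuclideanSpace ℝ (Fin n)) :
    ‖rieszIntegrand α f x y‖ₑ = ‖f y‖ₑ * rieszKernel α x y := by
  rw [rieszIntegrand, rieszKernel, ← ofReal_norm, ← ofReal_norm,
    ← ENNReal.ofReal_mul (norm_nonneg _), norm_div, RCLike.norm_ofReal,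
    abs_of_nonneg (by positivity), div_eq_mul_inv, ← Real.rpow_neg (norm_nonneg _), neg_sub]

theorem stronglyMeasurable_rieszIntegrand {f : EuclideanSpace ℝ (Fin n) → 𝕜}
    (hf : StronglyMeasurable f) :
    StronglyMeasurable (Function.uncurry (rieszIntegrand α f)) := by
  have h1 : StronglyMeasurable fun z : EuclideanSpace ℝ (Fin n) × EuclideanSpace ℝ (Fin n) =>
      (((‖z.1 - z.2‖ ^ ((n : ℝ) - α))⁻¹ : ℝ) : 𝕜) := by
    refine RCLike.continuous_ofReal.comp_stronglyMeasurable (Measurable.stronglyMeasurable ?_)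
    fun_prop
  have h2 := (hf.comp_measurable (measurable_snd (α := EuclideanSpace ℝ (Fin n)))).mul h1
  convert h2 using 1
  funext z
  simp [Function.uncurry, rieszIntegrand, div_eq_mul_inv]

end Potential

/-- The weighted modular estimate for any `ψ` dominated by the dyadic Hardy operator of `φ`. -/
theorem exists_modular_hardy_bound {ℓ : ℝ≥0∞} {e q : ℝ → ℝ} {θ0 θ1 q0 q1 C β : ℝ}
    (he : LogNear ℓ e θ0 θ1 C) (hq : LogNear ℓ q q0 q1 C)
    (hq1 : ∀ᵐ t ∂(lineMeasure ℓ), 1 ≤ q t) (hβ : 0 ≤ β) (hθ0 : β < θ0 ∧ θ0 < 1)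
    (hθ1 : β < θ1 ∧ θ1 < 1) (h0 : 1 ≤ q0) (h1 : 1 ≤ q1) (K : ℝ≥0) :
    ∃ M : ℝ≥0, 0 < M ∧ ∀ φ : ℝ → ℝ≥0∞, Antitone φ → (∀ t, ℓ ≤ ENNReal.ofReal t → φ t = 0) →
      ∫⁻ t, (ENNReal.ofReal (t ^ (e t - 1 / q t)) * φ t) ^ q t ∂(lineMeasure ℓ) ≤ 1 →
      (∀ s : ℝ≥0∞, 0 < s → ∃ j : ℤ, φ ((2 : ℝ) ^ j) < s) ∧
      (∀ k : ℤ, dyadicHardy β (fun j => φ ((2 : ℝ) ^ j)) k < ∞) ∧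
      ∀ ψ : ℝ → ℝ≥0∞, Antitone ψ →
        (∀ k : ℤ, ψ ((2 : ℝ) ^ k) ≤ K * dyadicHardy β (fun j => φ ((2 : ℝ) ^ j)) k) →
        ∫⁻ t, (ENNReal.ofReal (t ^ (e t - β - 1 / q t)) * (ψ t / M)) ^ q t ∂(lineMeasure ℓ) ≤ 1 := by
  set ε := min (min (θ0 - β) (1 - θ0)) (min (θ1 - β) (1 - θ1)) with hε
  have hε0 : 0 < ε := by
    simp only [hε, lt_min_iff]
    exact ⟨⟨by linarith, by linarith⟩, by linarith, by linarith⟩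
  have hεθ0 : ε ≤ θ0 - β ∧ ε ≤ 1 - θ0 :=
    ⟨(min_le_left _ _).trans (min_le_left _ _), (min_le_left _ _).trans (min_le_right _ _)⟩
  have hεθ1 : ε ≤ θ1 - β ∧ ε ≤ 1 - θ1 :=
    ⟨(min_le_right _ _).trans (min_le_left _ _), (min_le_right _ _).trans (min_le_right _ _)⟩
  obtain ⟨N, hN0, hN⟩ := exists_convolution_bound hε0 q0 q1 h0 h1
  have hT : ∑' j : ℤ, (2 : ℝ≥0∞) ^ (-1 * |(j : ℝ)|) ≠ ∞ :=
    tsum_two_rpow_neg_abs_ne_top one_pos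
  set T := ∑' j : ℤ, (2 : ℝ≥0∞) ^ (-1 * |(j : ℝ)|) with hTdef
  obtain ⟨S, hS⟩ : ∃ S : ℝ≥0, (S : ℝ≥0∞) = 2 ^ (2 * C + 1) + T :=
    ⟨_, ENNReal.coe_toNNReal (ENNReal.add_ne_top.2 ⟨two_rpow_ne_top _, hT⟩)⟩
  obtain ⟨L', hL'⟩ : ∃ L' : ℝ≥0, (L' : ℝ≥0∞) = 2 ^ (2 * C) * ((N * S + N * N : ℝ≥0) : ℝ≥0∞) + T :=
    ⟨_, ENNReal.coe_toNNReal (ENNReal.add_ne_top.2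
      ⟨ENNReal.mul_ne_top (two_rpow_ne_top _) ENNReal.coe_ne_top, hT⟩)⟩
  set L := max 1 L' with hLdef
  have hL1 : 1 ≤ L := le_max_left _ _
  have hL0 : (L : ℝ≥0∞) ≠ 0 := by exact_mod_cast (zero_lt_one.trans_le hL1).ne'
  have hNne : (N : ℝ≥0∞) ≠ 0 := by exact_mod_cast hN0.ne'
  -- The power of `2` undoes both dyadic losses, `N` normalizes the convolution, and `L` the final
  -- modular; `K + 1` keeps `M` positive.
  obtain ⟨M, hM⟩ : ∃ M : ℝ≥0, (M : ℝ≥0∞) = ((K + 1 : ℝ≥0) : ℝ≥0∞) * 2 ^ (1 + C + (2 + C)) * N * L :=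
    ⟨_, ENNReal.coe_toNNReal (by finiteness)⟩
  have hM0 : (M : ℝ≥0∞) ≠ 0 := by
    rw [hM]
    have : ((K + 1 : ℝ≥0) : ℝ≥0∞) ≠ 0 := by exact_mod_cast (by positivity : K + 1 ≠ 0)
    exact mul_ne_zero (mul_ne_zero (mul_ne_zero this (two_rpow_ne_zero _)) hNne) hL0
  refine ⟨M, by exact_mod_cast pos_iff_ne_zero.2 hM0, fun φ hφ hφℓ hmod => ?_⟩
  set F : ℤ → ℝ≥0∞ := fun j => 2 ^ ((j : ℝ) * twoSided θ0 θ1 j) * φ (2 ^ j) with hF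
  set G : ℤ → ℝ≥0∞ := fun j => 2 ^ (-(2 + C)) * F j with hG
  have hFG : ∀ j, F j = 2 ^ (2 + C) * G j := fun j => by
    rw [hG]
    simp only
    rw [← mul_assoc, ← two_rpow_add]; simp
  obtain ⟨hG1, hGS⟩ := modular_dyadic_le he hq hq1 ⟨by linarith, by linarith⟩
    ⟨by linarith, by linarith⟩ h0 h1 hφ hφℓ hmod (G := G) fun j => rfl
  obtain ⟨hconv, hconvS⟩ := hN S G hG1 (hGS.trans_eq hS.symm)
  set H : ℤ → ℝ≥0∞ := fun k => (∑' j : ℤ, 2 ^ (-ε * |(k : ℝ) - j|) * G j) / N with hH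
  have hH1 : ∀ k, H k ≤ 1 := fun k =>
    ENNReal.div_le_of_le_mul (by rw [one_mul]; exact hconv k)
  have hhardy : ∀ k : ℤ, 2 ^ ((k : ℝ) * (twoSided θ0 θ1 k - β)) *
      dyadicHardy β (fun j => φ ((2 : ℝ) ^ j)) k ≤ 2 ^ (2 + C) * (N * H k) := fun k => by
    refine (two_rpow_mul_dyadicHardy_le hεθ0 hεθ1 _ k).trans (le_of_eq ?_)
    rw [hH]
    simp only
    rw [ENNReal.mul_div_cancel hNne ENNReal.coe_ne_top, ← ENNReal.tsum_mul_left]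
    refine tsum_congr fun j => ?_
    rw [show 2 ^ ((j : ℝ) * twoSided θ0 θ1 j) * φ ((2 : ℝ) ^ j) = F j from rfl, hFG]
    ring
  refine ⟨fun s hs => ?_, fun k => ?_, fun ψ hψ hψK => ?_⟩
  -- From `G m ≤ 1` comes `φ (2 ^ m) ≤ 2 ^ (2 + C) * 2 ^ (-m θ1)`, and `θ1 > β ≥ 0`.
  · have hlim : Tendsto (fun m : ℕ => (2 : ℝ≥0∞) ^ (2 + C) * ((2 : ℝ≥0∞) ^ (-θ1)) ^ m) atTop
        (𝓝 (2 ^ (2 + C) * 0)) := by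
      refine ENNReal.Tendsto.const_mul (ENNReal.tendsto_pow_atTop_nhds_zero_of_lt_one ?_)
        (Or.inr (two_rpow_ne_top _))
      exact ENNReal.rpow_lt_one_of_one_lt_of_neg (by simp) (by linarith)
    rw [mul_zero] at hlim
    obtain ⟨m, hm⟩ := (hlim.eventually_lt_const hs).exists
    refine ⟨m, lt_of_le_of_lt ?_ hm⟩
    have hFm : F m ≤ 2 ^ (2 + C) := by
      rw [hFG]
      exact mul_le_of_le_one_right bot_le (hG1 m)
    have htw : twoSided θ0 θ1 m = θ1 := by simp [twoSided]
    calc φ (2 ^ (m : ℤ)) = F m * (2 ^ (-θ1)) ^ m := by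
          simp only [hF]
          rw [htw, mul_right_comm, ← ENNReal.rpow_natCast, ← ENNReal.rpow_mul, ← two_rpow_add]
          push_cast
          ring_nf
          simp
      _ ≤ _ := by gcongr
  · have h2 : dyadicHardy β (fun j => φ ((2 : ℝ) ^ j)) k =
        2 ^ (-((k : ℝ) * (twoSided θ0 θ1 k - β))) * (2 ^ ((k : ℝ) * (twoSided θ0 θ1 k - β)) *
          dyadicHardy β (fun j => φ ((2 : ℝ) ^ j)) k) := by
      rw [← mul_assoc, ← two_rpow_add]; simp
    rw [h2]
    refine ENNReal.mul_lt_top (two_rpow_ne_top _).lt_top ((hhardy k).trans_lt ?_)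
    have : H k ≠ ∞ := ((hH1 k).trans_lt ENNReal.one_lt_top).ne
    finiteness
  · refine modular_le_of_dyadic he hq hq1 ⟨by linarith, by linarith⟩ ⟨by linarith, by linarith⟩
      (ψ := fun t => ψ t / M) (fun s t hst => ENNReal.div_le_div_right (hψ hst) _) hH1
      (S := N * S + N * N) (by push_cast; exact hconvS) hL1 ?_ fun k => ?_
    · rw [← hL']
      exact_mod_cast le_max_right _ _
    · rw [← mul_div_assoc]
      refine ENNReal.div_le_of_le_mul ?_
      have hcancel : (2 : ℝ≥0∞) ^ (-(1 + C)) * (H k / L) * M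
          = (K + 1 : ℝ≥0) * (2 ^ (2 + C) * (N * H k)) := by
        have e1 : (2 : ℝ≥0∞) ^ (-(1 + C)) * 2 ^ (1 + C + (2 + C)) = 2 ^ (2 + C) := by
          rw [← two_rpow_add]; ring_nf
        have e2 : H k / L * L = H k := ENNReal.div_mul_cancel hL0 ENNReal.coe_ne_top
        calc _ = (K + 1 : ℝ≥0) * ((2 ^ (-(1 + C)) * 2 ^ (1 + C + (2 + C))) *
              (N * (H k / L * L))) := by rw [hM]; ring
          _ = _ := by rw [e1, e2]
      rw [hcancel]
      calc _ ≤ 2 ^ ((k : ℝ) * (twoSided θ0 θ1 k - β)) *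
              (K * dyadicHardy β (fun j => φ ((2 : ℝ) ^ j)) k) := mul_le_mul' le_rfl (hψK k)
        _ = K * (2 ^ ((k : ℝ) * (twoSided θ0 θ1 k - β)) *
              dyadicHardy β (fun j => φ ((2 : ℝ) ^ j)) k) := mul_left_comm _ _ _
        _ ≤ _ := by
            refine mul_le_mul' ?_ (hhardy k)
            exact_mod_cast le_self_add

theorem dyadicHardy_div (β : ℝ) (a : ℤ → ℝ≥0∞) (c : ℝ≥0∞) (k : ℤ) :
    dyadicHardy β (fun j => a j / c) k = dyadicHardy β a k / c := by
  simp only [dyadicHardy, div_eq_mul_inv, ← mul_assoc, ENNReal.tsum_mul_right]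

end VarLorentz

/-! ### Boundedness of the Riesz potential. -/

theorem mainTheorem3 {𝕜 : Type*} [RCLike 𝕜] (n : ℕ) (α : ℝ) (hα : 0 < α) (hαn : α < n)
    (Ω : Set (EuclideanSpace ℝ (Fin n))) (hΩ : IsOpen Ω)
    (μ : Measure (EuclideanSpace ℝ (Fin n))) (hμ : VarLorentz.UpperRegular μ Ω)
    (p q γ : ℝ → ℝ) (p0 pInf q0 qInf γ0 γInf : ℝ)
    (hp : VarLorentz.LogDecayAbove 1 (μ Ω) p p0 pInf)
    (hq : VarLorentz.LogDecayAbove 1 (μ Ω) q q0 qInf)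
    (hp0 : 1 < p0) (hpInf : μ Ω = ∞ → 1 < pInf)
    (hpn : VarLorentz.pPlus (μ Ω) p < ((n / α : ℝ) : EReal))
    (hγ : VarLorentz.LogDecay (μ Ω) γ γ0 γInf)
    (hγ0 : α / n - 1 / p0 < γ0 ∧ γ0 < 1 - 1 / p0)
    (hγInf : μ Ω = ∞ → α / n - 1 / pInf < γInf ∧ γInf < 1 - 1 / pInf) :
    ∃ C : ℝ≥0, ∀ f : EuclideanSpace ℝ (Fin n) → 𝕜,
      VarLorentz.MemLorentz (μ.restrict Ω) p q (VarLorentz.powerWeight γ) f →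
        (∀ᵐ x ∂(μ.restrict Ω), IntegrableOn (VarLorentz.rieszIntegrand α f x) Ω μ) ∧
        VarLorentz.MemLorentz (μ.restrict Ω) (VarLorentz.sobolevExponent n α p) q
          (VarLorentz.powerWeight γ) (VarLorentz.rieszPotential μ Ω α f) ∧
        VarLorentz.lorentzNorm (μ.restrict Ω) (VarLorentz.sobolevExponent n α p) q
            (VarLorentz.powerWeight γ) (VarLorentz.rieszPotential μ Ω α f) ≤
          C * VarLorentz.lorentzNorm (μ.restrict Ω) p q (VarLorentz.powerWeight γ) f := by
  open VarLorentz in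
  have := hμ.sigmaFinite hΩ.measurableSet
  set β := α / n with hβ
  have hn : (0 : ℝ) < n := hα.trans hαn
  have hp1 : ∀ᵐ t ∂(lineMeasure (μ Ω)), 1 ≤ p t := hp.ae_lt.mono fun t ht => ht.le
  have hq1 : ∀ᵐ t ∂(lineMeasure (μ Ω)), 1 ≤ q t := hq.ae_lt.mono fun t ht => ht.le
  obtain ⟨Cp, hCp⟩ := hp.toLogDecay.exists_logNear
  obtain ⟨Cq, hCq⟩ := hq.toLogDecay.exists_logNear
  obtain ⟨Cγ, hCγ⟩ := hγ.exists_logNear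
  set p1 := if μ Ω = ∞ then pInf else p0 with hp1def
  set q1 := if μ Ω = ∞ then qInf else q0 with hq1def
  set γ1 := if μ Ω = ∞ then γInf else γ0 with hγ1def
  have hp1' : 1 < p1 := by
    rw [hp1def]; split_ifs with h
    exacts [hpInf h, hp0]
  have hγ1 : β - 1 / p1 < γ1 ∧ γ1 < 1 - 1 / p1 := by
    rw [hp1def, hγ1def]; split_ifs with h
    exacts [hγInf h, hγ0]
  set e : ℝ → ℝ := fun t => γ t + 1 / p t with he
  have hCe := hCγ.add (hCp.one_div hp1 hp0.le hp1'.le)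
  obtain ⟨K, hK⟩ := exists_measure_dyadicHardy_lt_absPotential_le (𝕜 := 𝕜) hα hαn
    hΩ.measurableSet hμ
  obtain ⟨M, hM0, hM⟩ := exists_modular_hardy_bound (β := β) (hCe.mono (le_max_left _ Cq))
    ((hCq.max_one hq1).mono (le_max_right _ _)) hq1 (by positivity)
    ⟨by linarith [hγ0.1], by linarith [hγ0.2]⟩ ⟨by linarith [hγ1.1], by linarith [hγ1.2]⟩
    (le_max_right _ _) (le_max_right _ _) K
  refine ⟨M, fun f ⟨hfm, hfnorm⟩ => ?_⟩
  set ν := μ.restrict Ω with hν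
  have hνuniv : ν univ = μ Ω := by simp [hν]
  set g := hfm.mk f with hg
  have hgm : StronglyMeasurable g := hfm.stronglyMeasurable_mk
  have hfg : f =ᵐ[ν] g := hfm.ae_eq_mk
  have hpot : rieszPotential μ Ω α f = rieszPotential μ Ω α g := by
    funext x
    refine integral_congr_ae ?_
    filter_upwards [hfg] with y hy
    simp [rieszIntegrand, hy]
  have hUle : ∀ x, ‖rieszPotential μ Ω α g x‖ₑ ≤ absPotential ν α g x := fun x => by
    refine (enorm_integral_le_lintegral_enorm _).trans (le_of_eq ?_)
    simp_rw [enorm_rieszIntegrand]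
    rfl
  -- Every constant admissible in the norm of `f` becomes, after multiplication by `M`, admissible
  -- for the potential; the norm estimate follows by taking the infimum over `c`.
  have hcore : ∀ c : ℝ≥0, 0 < c →
      ∫⁻ t, (ENNReal.ofReal (powerWeight γ t * t ^ (1 / p t - 1 / q t)) * rearrangement ν f t /
        (c : ℝ≥0∞)) ^ q t ∂(lineMeasure (ν univ)) ≤ 1 →
      (∀ᵐ x ∂ν, absPotential ν α g x < ∞) ∧
      lorentzNorm ν (sobolevExponent n α p) q (powerWeight γ) (rieszPotential μ Ω α g) ≤
        M * c := fun c hc hmod => by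
    have hc0 : (c : ℝ≥0∞) ≠ 0 := by exact_mod_cast hc.ne'
    rw [rearrangement_congr hfg, hνuniv, lorentz_modular_eq (e := e) fun _ => rfl] at hmod
    obtain ⟨hsmall, hfin, hbound⟩ := hM (fun t => rearrangement ν g t / c)
      (fun s t hst => ENNReal.div_le_div_right (rearrangement_antitone ν g hst) _)
      (fun t ht => by simp [rearrangement_eq_zero (ν := ν) (hνuniv.le.trans ht)]) hmod
    have hsmall' : ∀ s : ℝ≥0∞, 0 < s → ∃ j : ℤ, rearrangement ν g ((2 : ℝ) ^ j) < s := by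
      intro s hs
      obtain ⟨j, hj⟩ := hsmall (s / c) (ENNReal.div_pos hs.ne' ENNReal.coe_ne_top)
      refine ⟨j, ?_⟩
      by_contra! hle
      exact absurd (ENNReal.div_le_div_right hle _) (not_le.2 hj)
    have hlevel := hK g hgm hsmall'
    simp_rw [dyadicHardy_div] at hfin hbound
    set B := dyadicHardy β fun j => rearrangement ν g ((2 : ℝ) ^ j) with hB
    have hBfin : ∀ k, B k ≠ ∞ := fun k hk => by
      have := hfin k
      rw [hk, ENNReal.top_div_of_ne_top ENNReal.coe_ne_top] at this
      exact lt_irrefl _ this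
    refine ⟨?_, ?_⟩
    -- The set where the potential of `|g|` is infinite lies in each exceptional set of O'Neil's
    -- inequality at `2 ^ (-m)`, because the Hardy bounds are finite.
    · rw [ae_iff]
      refine le_antisymm (ENNReal.le_of_forall_pos_le_add fun ε hε _ => ?_) bot_le
      obtain ⟨m, hm⟩ := exists_pow_lt_of_lt_one (show (0 : ℝ) < ε by exact_mod_cast hε)
        (show (1 / 2 : ℝ) < 1 by norm_num)
      calc _ ≤ ν {x | K * B (-(m : ℤ)) < absPotential ν α g x} := by
            refine measure_mono fun x (hx : ¬ absPotential ν α g x < ∞) => ?_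
            rw [not_lt_top_iff] at hx
            change (K : ℝ≥0∞) * B (-(m : ℤ)) < absPotential ν α g x
            rw [hx]
            exact (ENNReal.mul_ne_top ENNReal.coe_ne_top (hBfin _)).lt_top
        _ ≤ ENNReal.ofReal ((2 : ℝ) ^ (-(m : ℤ))) := hlevel _
        _ ≤ ENNReal.ofReal ε := by
            refine ENNReal.ofReal_le_ofReal (le_trans (le_of_eq ?_) hm.le)
            simp
        _ = 0 + ε := by simp
    · have hψ := hbound (fun t => rearrangement ν (rieszPotential μ Ω α g) t / c)
        (fun s t hst => ENNReal.div_le_div_right (rearrangement_antitone ν _ hst) _) fun k => by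
          rw [← mul_div_assoc]
          refine ENNReal.div_le_div_right (rearrangement_le ?_) _
          exact (measure_mono fun x hx => lt_of_lt_of_le hx (hUle x)).trans (hlevel k)
      unfold lorentzNorm luxemburgNorm
      refine iInf_le_of_le (M * c) (iInf_le_of_le (mul_pos hM0 hc) (iInf_le_of_le ?_ ?_))
      · rw [hνuniv, lorentz_modular_eq (e := fun t => e t - β) fun t => ?_]
        · refine le_trans (le_of_eq ?_) hψ
          refine lintegral_congr fun t => ?_
          congr 2
          rw [ENNReal.coe_mul, div_eq_mul_inv, div_eq_mul_inv, div_eq_mul_inv,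
            ENNReal.mul_inv (Or.inr ENNReal.coe_ne_top) (Or.inl ENNReal.coe_ne_top)]
          ring
        · simp only [he, sobolevExponent, one_div, inv_inv, hβ]
          ring
      · push_cast; rfl
  have hle : lorentzNorm ν (sobolevExponent n α p) q (powerWeight γ) (rieszPotential μ Ω α f) ≤
      M * lorentzNorm ν p q (powerWeight γ) f := by
    have hM0' : (M : ℝ≥0∞) ≠ 0 := by exact_mod_cast hM0.ne'
    rw [hpot, mul_comm, ← ENNReal.div_le_iff_le_mul (Or.inl hM0') (Or.inl ENNReal.coe_ne_top)]
    refine le_iInf fun c => le_iInf fun hc => le_iInf fun hmod => ?_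
    rw [ENNReal.div_le_iff_le_mul (Or.inl hM0') (Or.inl ENNReal.coe_ne_top), mul_comm]
    exact (hcore c hc hmod).2
  refine ⟨?_, ⟨?_, hle.trans_lt (ENNReal.mul_lt_top ENNReal.coe_lt_top hfnorm)⟩, hle⟩
  · obtain ⟨c, hc, hmod⟩ : ∃ c : ℝ≥0, 0 < c ∧
      ∫⁻ t, (ENNReal.ofReal (powerWeight γ t * t ^ (1 / p t - 1 / q t)) * rearrangement ν f t /
        (c : ℝ≥0∞)) ^ q t ∂(lineMeasure (ν univ)) ≤ 1 := by
      simpa [lorentzNorm, luxemburgNorm, iInf_lt_iff] using hfnorm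
    filter_upwards [(hcore c hc hmod).1] with x hx
    have hint : Integrable (rieszIntegrand α g x) ν := by
      refine ⟨((stronglyMeasurable_rieszIntegrand hgm).of_uncurry_left).aestronglyMeasurable, ?_⟩
      rw [HasFiniteIntegral]
      simp_rw [enorm_rieszIntegrand]
      exact hx
    refine hint.congr ?_
    filter_upwards [hfg] with y hy
    simp [rieszIntegrand, hy]
  · rw [hpot]
    exact (StronglyMeasurable.integral_prod_right
      (stronglyMeasurable_rieszIntegrand hgm)).aestronglyMeasurable
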